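/- Let $1\le K\le M$. A transmitter with $M$ antennas serves $K$ single-antenna users over the broadcast channel $y_k=h_kx+z_k$, where the channel vectors $h_1,\dots,h_K\in\mathbb C^{1\times M}$ have i.i.d. circularly symmetric complex Gaussian entries of unit variance and the noise has unit variance; the total transmit power is at most $\rho$. Let $\mu_1>\dots>\mu_K>0$ be weights with $\sum_k\mu_k=1$. The transmitter uses dirty paper coding (DPC), the users being encoded in the order $1,\dots,K$ (decreasing weights; increasing weights for the decoding in the dual uplink), with a precoder that decomposes the channel into parallel single-user channels: with transmit vectors $w_1,\dots,w_K$ such that $\sum_k\|w_k\|^2\le\rho$ and $h_iw_j=0$ for $i<j$, user $k$ has rate $$R_k=\log\Bigl(1+\frac{|h_kw_k|^2}{1+\sum_{j>k}|h_kw_j|^2}\Bigr).$$ Let $C(\rho)$ be either * the weighted sum rate $\sum_k\mu_k\log\bigl(1+\mu_k\rho\|f_k\|^2\bigr)$ of DPC at high SNR with power proportional to the weights, where $f_k$ is the projection of $h_k$ onto the orthogonal complement of $h_1,\dots,h_{k-1}$; or * the maximum of $\sum_k\mu_kR_k$ over all these precoders. In both cases the diversity-multiplexing tradeoff (DMT)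 under a fixed weighted sum rate is the same function $d:[0,K]\to\mathbb R$. That is, for every $r\in[0,K]$ and all target rates $R(\rho)$, bounded away from $0$, with $R(\rho)/\log\rho\to r$ (for example $R=r\log\rho$ if $r>0$, and $R$ a positive constant if $r=0$), one has $$\lim_{\rho\to\infty}\frac{\log\Pr\{K\,C(\rho)\le R(\rho)\}}{\log\rho}=-d(r).$$ The function $d$ is the piecewise linear function that connects the points $(r(i),d(i))$, $i=0,\dots,K$, with $$r(i)=K\Bigl(1-\sum_{j=1}^{K-i}\hat\mu_j\Bigr),\qquad d(i)=\sum_{j=1}^{K-i}\hat n_j ,$$ where $n_j=M-j+1$, and $\hat\mu_j=\mu_{i_j}$, $\hat n_j=n_{i_j}$ for any ordering $i_1,\dots,i_K$ of the users with $\mu_{i_1}/n_{i_1}\ge\dots\ge\mu_{i_K}/n_{i_K}$. -/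

import Mathlib

open Filter Topology MeasureTheory ProbabilityTheory

noncomputable section

namespace BroadcastDMT

/-- The circularly symmetric complex Gaussian law with mean `0` and unit variance `E|Z|² = 1`:
real and imaginary parts are independent with law `N(0, 1/2)`. -/
def complexGaussian : Measure ℂ :=
  ((gaussianReal 0 (1 / 2)).prod (gaussianReal 0 (1 / 2))).map Complex.equivRealProd.symm

/-- The channel vector `h_k ∈ ℂ^M` of every user; user `k` receives `y_k = h_k x + n_k`.
Users are numbered `0, …, K - 1`. -/
abbrev Channel (K M : ℕ) : Type := Fin K → EuclideanSpace ℂ (Fin M)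

/-- The noiseless signal `h x = ∑ m, h_m x_m` (no conjugation) received on channel vector `h`. -/
def received {M : ℕ} (h x : EuclideanSpace ℂ (Fin M)) : ℂ := ∑ m, h m * x m

/-- The signal-to-interference-plus-noise ratio of user `k` under dirty paper coding with encoding
order `0, 1, …, K - 1` and transmit vectors `w j` (so that `‖w j‖²` is the power given to user `j`,
and the noise has unit variance). Interference of users encoded earlier is removed
by the dirty paper code, that of users encoded later is noise. -/
def dpcSINR {K M : ℕ} (h : Channel K M) (w : Fin K → EuclideanSpace ℂ (Fin M)) (k : Fin K) : ℝ :=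
  ‖received (h k) (w k)‖ ^ 2 / (1 + ∑ j : Fin K with k < j, ‖received (h k) (w j)‖ ^ 2)

/-- The rate (in nats) of user `k` under dirty paper coding. -/
def dpcRate {K M : ℕ} (h : Channel K M) (w : Fin K → EuclideanSpace ℂ (Fin M)) (k : Fin K) : ℝ :=
  Real.log (1 + dpcSINR h w k)

/-- Admissible dirty paper precoders for total power `ρ`: the total power is at most `ρ`, and the
channel is decomposed into parallel single-user channels, that is, the transmit vector of a user
causes no interference at the users encoded before it. -/
def IsDPCPrecoder {K M : ℕ} (h : Channel K M) (ρ : ℝ)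
    (w : Fin K → EuclideanSpace ℂ (Fin M)) : Prop :=
  (∑ k, ‖w k‖ ^ 2) ≤ ρ ∧ ∀ i j : Fin K, i < j → received (h i) (w j) = 0

/-- The largest weighted sum rate `∑ μ_k R_k` over the admissible dirty paper precoders. -/
def maxWeightedSumRate {K M : ℕ} (μ : Fin K → ℝ) (h : Channel K M) (ρ : ℝ) : ℝ :=
  sSup {s | ∃ w, IsDPCPrecoder h ρ w ∧ s = ∑ k, μ k * dpcRate h w k}

/-- `f_k`: the orthogonal projection of `h_k` onto the orthogonal complement of
`h_0, …, h_{k-1}`. -/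
def projVec {K M : ℕ} (h : Channel K M) (k : Fin K) : EuclideanSpace ℂ (Fin M) :=
  (Submodule.span ℂ (h '' {j | j < k}))ᗮ.starProjection (h k)

/-- The high-SNR weighted sum rate of dirty paper coding, with power allocated proportionally to
the weights: `∑ μ_k log (1 + μ_k ρ ‖f_k‖²)`. -/
def propWeightedSumRate {K M : ℕ} (μ : Fin K → ℝ) (h : Channel K M) (ρ : ℝ) : ℝ :=
  ∑ k, μ k * Real.log (1 + μ k * ρ * ‖projVec h k‖ ^ 2)

/-- The outage probability `P {K * C ≤ R}` of a random weighted sum rate `C` of `K` users at the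
target rate `R`. -/
def outageProb {Ω : Type*} [MeasurableSpace Ω] (P : Measure Ω) (K : ℕ) (C : Ω → ℝ) (R : ℝ) : ℝ :=
  P.real {ω | (K : ℝ) * C ω ≤ R}

/-- `d` is the diversity order at multiplexing gain `r` of the system whose weighted sum rate at
signal-to-noise ratio `ρ` is `C ρ`: for all target rates `R ρ`, bounded away from `0`, with
`R ρ / log ρ → r` (for `r > 0`, in particular, `R ρ = r log ρ`, and for `r = 0` every positive
constant rate) the outage probability is positive for large `ρ` and decays like `ρ ^ (-d)`, in the
sense that `log P_out / log ρ → -d`. -/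
def HasDiversity {Ω : Type*} [MeasurableSpace Ω] (P : Measure Ω) (K : ℕ) (C : ℝ → Ω → ℝ)
    (r d : ℝ) : Prop :=
  ∀ R : ℝ → ℝ, (∃ c > 0, ∀ᶠ ρ in atTop, c ≤ R ρ) →
    Tendsto (fun ρ => R ρ / Real.log ρ) atTop (𝓝 r) →
      (∀ᶠ ρ in atTop, 0 < outageProb P K (C ρ) (R ρ)) ∧
      Tendsto (fun ρ => Real.log (outageProb P K (C ρ) (R ρ)) / Real.log ρ) atTop (𝓝 (-d))

/-- `d` is, on the range `[0, K]` of multiplexing gains, the diversity-multiplexing tradeoff of the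
system with weighted sum rate `C ρ`. -/
def IsDMT {Ω : Type*} [MeasurableSpace Ω] (P : Measure Ω) (K : ℕ) (C : ℝ → Ω → ℝ)
    (d : ℝ → ℝ) : Prop :=
  ∀ r ∈ Set.Icc (0 : ℝ) K, HasDiversity P K C r (d r)

/-- `d` is the piecewise linear function connecting the points `(x i, y i)`, `i = 0, …, N`. -/
def ConnectsPoints (d : ℝ → ℝ) (N : ℕ) (x y : ℕ → ℝ) : Prop :=
  (∀ i ≤ N, d (x i) = y i) ∧
  ∀ i < N, ∀ t ∈ Set.Icc (0 : ℝ) 1,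
    d ((1 - t) * x i + t * x (i + 1)) = (1 - t) * y i + t * y (i + 1)

/-- The number of degrees of freedom of the equivalent channel of a user: `M - j + 1` for
the `j`-th user, which has index `k = j - 1` here (in use `k < K ≤ M`, so nothing is truncated). -/
def dof (M : ℕ) {K : ℕ} (k : Fin K) : ℕ := M - (k : ℕ)

/-- The multiplexing gains `r(i) = K (1 - ∑_{j ≤ K - i} μ̂_j)` with `μ̂ = μ ∘ σ`. -/
def gainPoint {K : ℕ} (μ : Fin K → ℝ) (σ : Equiv.Perm (Fin K)) (i : ℕ) : ℝ :=
  K * (1 - ∑ j : Fin K with j.val < K - i, μ (σ j))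

/-- The diversities `d(i) = ∑_{j ≤ K - i} n̂_j` with `n̂ = n ∘ σ`, where `n_j = M - j + 1`. -/
def diversityPoint (M : ℕ) {K : ℕ} (σ : Equiv.Perm (Fin K)) (i : ℕ) : ℝ :=
  ∑ j : Fin K with j.val < K - i, (dof M (σ j) : ℝ)

end BroadcastDMT

end

/-!
With zero-forcing, every user sees only its own signal, and its rate is at most that of the scalar
channel with gain `X k = ‖f_k‖²` and the whole power. Hence both weighted sum
rates lie between `∑ μ_k log (1 + μ_k ρ X_k)` and `∑ μ_k log (1 + ρ X_k)`
(`propWeightedSumRate_le_maxWeightedSumRate`, `maxWeightedSumRate_le`), and it suffices to bound the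
outage probability of the first sum from above, and that of the second from below. These have the
same exponent, as the factors `μ_k` only change constants.

By the unitary invariance of the Gaussian vector, the `X k` are independent, and `X k` has the law
of the squared norm of `n_k = dof M k` standard complex Gaussian coordinates
(`lintegral_prod_projVec`). This gives `P (∀ k, X k ≤ t k) ≥ c ∏ t_k ^ n_k` and, for `a < n_k`,
`E (1 + c X_k) ^ (-a) ≤ C c ^ (-a)`.

With `X k` of size `ρ ^ (-v k)`, outage at multiplexing gain `r` means `K ∑ μ_k (1 - v_k) ≤ r`, and
has probability of order `ρ ^ (-∑ n_k v_k)`. The small-ball bound turns any feasible `v` into a lower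
bound for the outage probability (`exists_le_outageProb`). For the upper bound, the Chernoff bound
with parameter `s` (`exists_propWeightedSumRate_le`, `exists_outageProb_le`) yields the exponent
`∑ min (s μ_k) n_k - s r / K`, which is the Lagrange dual of minimizing `∑ n_k v_k`. This linear
program is a fractional knapsack problem: the greedy solution in the order of decreasing
`μ_k / n_k` and the multiplier of its fractional user have the same value
(`exists_primal_dual`), and that value runs through the piecewise linear curve.
-/

namespace BroadcastDMT

open scoped ENNReal

/-! ### The complex Gaussian vector and its rotation invariance -/

instance : IsProbabilityMeasure complexGaussian :=
  Measure.isProbabilityMeasure_map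
    (Complex.measurableEquivRealProd.symm.measurable.aemeasurable)

/-- The law on `ℂ^M` of a vector with i.i.d. standard complex Gaussian entries. -/
noncomputable def gaussianVector (M : ℕ) : Measure (EuclideanSpace ℂ (Fin M)) :=
  (Measure.pi fun _ : Fin M => complexGaussian).map (WithLp.toLp 2)

instance (M : ℕ) : IsProbabilityMeasure (gaussianVector M) :=
  Measure.isProbabilityMeasure_map
    ((MeasurableEquiv.toLp 2 (Fin M → ℂ)).measurable.aemeasurable)

lemma integral_complexGaussian (F : ℂ → ℂ) :
    ∫ w, F w ∂complexGaussian =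
      ∫ p : ℝ × ℝ, F ⟨p.1, p.2⟩ ∂(gaussianReal 0 (1 / 2)).prod (gaussianReal 0 (1 / 2)) := by
  have h := integral_map_equiv (μ := (gaussianReal 0 (1 / 2)).prod (gaussianReal 0 (1 / 2)))
    Complex.measurableEquivRealProd.symm F
  exact h

lemma lintegral_complexGaussian (F : ℂ → ℝ≥0∞) :
    ∫⁻ w, F w ∂complexGaussian =
      ∫⁻ p : ℝ × ℝ, F ⟨p.1, p.2⟩ ∂(gaussianReal 0 (1 / 2)).prod (gaussianReal 0 (1 / 2)) := by
  have h := lintegral_map_equiv (μ := (gaussianReal 0 (1 / 2)).prod (gaussianReal 0 (1 / 2)))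
    F Complex.measurableEquivRealProd.symm
  exact h

lemma charFun_complexGaussian (z : ℂ) :
    charFun complexGaussian z = Complex.exp (-(‖z‖ ^ 2 / 4 : ℝ)) := by
  have h : charFun complexGaussian z =
      charFun (gaussianReal 0 (1 / 2)) z.re * charFun (gaussianReal 0 (1 / 2)) z.im := by
    rw [charFun_apply, charFun_apply, charFun_apply, integral_complexGaussian, ← integral_prod_mul]
    congr 1
    ext p
    rw [← Complex.exp_add]
    simp [Complex.inner]
    ring_nf
  rw [h, charFun_gaussianReal, charFun_gaussianReal, ← Complex.exp_add, ← Complex.normSq_eq_norm_sq,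
    Complex.normSq_apply]
  congr 1
  push_cast
  ring

lemma charFun_gaussianVector {M : ℕ} (t : EuclideanSpace ℂ (Fin M)) :
    charFun (gaussianVector M) t = Complex.exp (-(‖t‖ ^ 2 / 4 : ℝ)) := by
  rw [gaussianVector, charFun_pi]
  simp_rw [charFun_complexGaussian]
  rw [← Complex.exp_sum, EuclideanSpace.norm_sq_eq]
  congr 1
  push_cast
  rw [Finset.sum_neg_distrib, Finset.sum_div]

/-- The Gaussian vector is invariant under unitary maps: its characteristic function depends only
on the norm of its argument. -/
lemma map_gaussianVector {M : ℕ}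
    (U : EuclideanSpace ℂ (Fin M) ≃ₗᵢ[ℂ] EuclideanSpace ℂ (Fin M)) :
    (gaussianVector M).map U = gaussianVector M := by
  have hU : Measurable U := U.continuous.measurable
  have : IsProbabilityMeasure ((gaussianVector M).map U) :=
    Measure.isProbabilityMeasure_map hU.aemeasurable
  apply Measure.ext_of_charFun
  ext t
  let V : EuclideanSpace ℂ (Fin M) ≃ₗᵢ[ℝ] EuclideanSpace ℂ (Fin M) :=
    ⟨U.toLinearEquiv.restrictScalars ℝ, U.norm_map⟩
  have hV : ∀ x, inner ℝ (U x) t = inner ℝ x (V.symm t) := fun x => by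
    rw [← V.inner_map_map x, V.apply_symm_apply]
    rfl
  have h : charFun ((gaussianVector M).map U) t = charFun (gaussianVector M) (V.symm t) := by
    rw [charFun_apply, charFun_apply, integral_map hU.aemeasurable (by fun_prop)]
    simp_rw [hV]
  rw [h, charFun_gaussianVector, charFun_gaussianVector, V.symm.norm_map]

/-- The squared norm of the first `n` coordinates of a vector. -/
noncomputable def headNormSq {M : ℕ} (n : ℕ) (x : EuclideanSpace ℂ (Fin M)) : ℝ :=
  ∑ i : Fin M with i.val < n, ‖x i‖ ^ 2

lemma measurable_headNormSq {M : ℕ} (n : ℕ) :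
    Measurable (headNormSq n : EuclideanSpace ℂ (Fin M) → ℝ) := by
  unfold headNormSq
  fun_prop

/-- In suitable unitary coordinates, the projection to a subspace of dimension `n` is the projection
to the first `n` coordinates. -/
lemma exists_isometry_norm_starProjection_sq {M n : ℕ}
    (W : Submodule ℂ (EuclideanSpace ℂ (Fin M))) (hW : Module.finrank ℂ W = n) :
    ∃ U : EuclideanSpace ℂ (Fin M) ≃ₗᵢ[ℂ] EuclideanSpace ℂ (Fin M),
      ∀ x, ‖W.starProjection x‖ ^ 2 = headNormSq n (U x) := by
  subst hW
  have hn : Module.finrank ℂ W ≤ M := by simpa using W.finrank_le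
  let w := stdOrthonormalBasis ℂ W
  let v : Fin M → EuclideanSpace ℂ (Fin M) := fun i =>
    if h : i.val < Module.finrank ℂ W then (w ⟨i, h⟩ : EuclideanSpace ℂ (Fin M)) else 0
  have hv : ∀ (i : Fin M) (h : i.val < Module.finrank ℂ W), v i = w ⟨i, h⟩ := fun i h => by
    simp [v, h]
  have horth : Orthonormal ℂ (({i : Fin M | i.val < Module.finrank ℂ W}).domRestrict v) := by
    have h1 : Orthonormal ℂ (fun i => (w i : EuclideanSpace ℂ (Fin M))) :=
      w.orthonormal.comp_linearIsometry W.subtypeₗᵢ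
    have h2 := h1.comp (fun i : {i : Fin M | i.val < Module.finrank ℂ W} => ⟨i.1.1, i.2⟩)
      (fun i j hij => by
        have := congrArg Fin.val hij
        exact Subtype.ext (Fin.ext this))
    convert h2 using 1
    ext1 i
    exact hv i.1 i.2
  obtain ⟨b, hb⟩ := horth.exists_orthonormalBasis_extension_of_card_eq (by simp)
  refine ⟨b.repr, fun x => ?_⟩
  have h1 : ‖W.starProjection x‖ ^ 2 = ∑ i, ‖inner ℂ (w i : EuclideanSpace ℂ (Fin M)) x‖ ^ 2 := by
    rw [Submodule.starProjection_apply, Submodule.norm_coe, ← w.sum_sq_norm_inner_right]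
    simp_rw [Submodule.inner_orthogonalProjectionOnto_eq_of_mem_left]
  rw [h1, headNormSq]
  symm
  refine Finset.sum_bij' (fun i hi => ⟨i.1, (Finset.mem_filter.1 hi).2⟩)
    (fun i _ => ⟨i.1, i.2.trans_le hn⟩) (by simp) (by simp) (by simp) (by simp) ?_
  intro i hi
  have hi' := (Finset.mem_filter.1 hi).2
  rw [b.repr_apply_apply, hb i hi', hv i hi']

/-- The projection of a Gaussian vector to a subspace of dimension `n` has the law of its first `n`
coordinates. -/
lemma lintegral_norm_starProjection_sq {M n : ℕ} (W : Submodule ℂ (EuclideanSpace ℂ (Fin M)))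
    (hW : Module.finrank ℂ W = n) (f : ℝ → ℝ≥0∞) (hf : Measurable f) :
    ∫⁻ x, f (‖W.starProjection x‖ ^ 2) ∂gaussianVector M =
      ∫⁻ x, f (headNormSq n x) ∂gaussianVector M := by
  obtain ⟨U, hU⟩ := exists_isometry_norm_starProjection_sq W hW
  simp_rw [hU]
  conv_rhs => rw [← map_gaussianVector U]
  exact (lintegral_map (hf.comp (measurable_headNormSq n)) U.continuous.measurable).symm

/-! ### Independence of the projected channel vectors -/

/-- The projected channel vectors are produced by the Gram–Schmidt process. -/
lemma projVec_eq_gramSchmidt {K M : ℕ} (h : Channel K M) (k : Fin K) :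
    projVec h k = InnerProductSpace.gramSchmidt ℂ h k := by
  rw [projVec]
  apply Submodule.eq_starProjection_of_mem_orthogonal
  · rw [Submodule.mem_orthogonal]
    intro u hu
    induction hu using Submodule.span_induction with
    | mem x hx =>
      obtain ⟨j, hj, rfl⟩ := hx
      rw [inner_eq_zero_symm]
      exact InnerProductSpace.gramSchmidt_inv_triangular ℂ h hj
    | zero => simp
    | add x y _ _ hx hy => rw [inner_add_left, hx, hy, add_zero]
    | smul a x _ hx => rw [inner_smul_left, hx, mul_zero]
  · rw [Submodule.orthogonal_orthogonal]
    have h1 := InnerProductSpace.gramSchmidt_def' ℂ h k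
    have h2 : h k - InnerProductSpace.gramSchmidt ℂ h k =
        ∑ i ∈ Finset.Iio k, (Submodule.span ℂ {InnerProductSpace.gramSchmidt ℂ h i}).starProjection
          (h k) := by
      rw [InnerProductSpace.gramSchmidt_def ℂ h k, sub_sub_cancel]
    rw [h2]
    refine Submodule.sum_mem _ fun i hi => ?_
    have h3 : InnerProductSpace.gramSchmidt ℂ h i ∈ Submodule.span ℂ (h '' Set.Iio k) := by
      rw [← InnerProductSpace.span_gramSchmidt_Iio]
      exact Submodule.subset_span ⟨i, Finset.mem_Iio.1 hi, rfl⟩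
    exact (Submodule.span_le.2 (Set.singleton_subset_iff.2 h3))
      (Submodule.starProjection_apply_mem _ _)

lemma measurable_gramSchmidt {K M : ℕ} (k : Fin K) :
    Measurable fun h : Channel K M => InnerProductSpace.gramSchmidt ℂ h k := by
  induction k using WellFoundedLT.induction with
  | ind k ih =>
    simp_rw [InnerProductSpace.gramSchmidt_def ℂ _ k, Submodule.starProjection_singleton]
    refine Measurable.sub (measurable_pi_apply k) (Finset.measurable_fun_sum _ fun i hi => ?_)
    have hi := ih i (Finset.mem_Iio.1 hi)
    have hk : Measurable fun h : Channel K M => h k := measurable_pi_apply k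
    exact ((hi.inner hk).div (Complex.measurable_ofReal.comp (hi.norm.pow_const 2))).smul hi

lemma measurable_projVec {K M : ℕ} (k : Fin K) :
    Measurable fun h : Channel K M => projVec h k := by
  simp_rw [projVec_eq_gramSchmidt]
  exact measurable_gramSchmidt k

lemma projVec_snoc_castSucc {K M : ℕ} (h : Channel K M) (x : EuclideanSpace ℂ (Fin M))
    (k : Fin K) :
    projVec (Fin.snoc h x : Channel (K + 1) M) k.castSucc = projVec h k := by
  have hset : (Fin.snoc h x : Channel (K + 1) M) '' {j | j < k.castSucc} = h '' {j | j < k} := by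
    ext y
    constructor
    · rintro ⟨j, hj, rfl⟩
      induction j using Fin.lastCases with
      | last => exact absurd hj (by simp [Fin.le_last])
      | cast j => exact ⟨j, by simpa using hj, by simp⟩
    · rintro ⟨j, hj, rfl⟩
      exact ⟨j.castSucc, by simpa using hj, by simp⟩
  unfold projVec
  simp only [hset, Fin.snoc_castSucc]

lemma projVec_snoc_last {K M : ℕ} (h : Channel K M) (x : EuclideanSpace ℂ (Fin M)) :
    projVec (Fin.snoc h x : Channel (K + 1) M) (Fin.last K) =
      (Submodule.span ℂ (Set.range h))ᗮ.starProjection x := by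
  have hset : (Fin.snoc h x : Channel (K + 1) M) '' {j | j < Fin.last K} = Set.range h := by
    ext y
    constructor
    · rintro ⟨j, hj, rfl⟩
      induction j using Fin.lastCases with
      | last => exact absurd hj (by simp)
      | cast j => exact ⟨j, by simp⟩
    · rintro ⟨j, rfl⟩
      exact ⟨j.castSucc, by simp [Fin.castSucc_lt_last], by simp⟩
  unfold projVec
  simp only [hset, Fin.snoc_last]

lemma linearIndependent_of_projVec_ne_zero {M : ℕ} :
    ∀ {K : ℕ} (h : Channel K M), (∀ k, projVec h k ≠ 0) → LinearIndependent ℂ h := by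
  intro K
  induction K with
  | zero => exact fun h _ => linearIndependent_empty_type
  | succ K ih =>
    intro h hne
    obtain ⟨h, x, rfl⟩ : ∃ (h' : Channel K M) (x : EuclideanSpace ℂ (Fin M)),
        h = Fin.snoc h' x := ⟨Fin.init h, h (Fin.last K), (Fin.snoc_init_self h).symm⟩
    rw [linearIndependent_finSnoc]
    refine ⟨ih h fun k => ?_, fun hx => ?_⟩
    · rw [← projVec_snoc_castSucc h x k]
      exact hne _
    · apply hne (Fin.last K)
      rw [projVec_snoc_last, Submodule.starProjection_apply_eq_zero_iff,
        Submodule.orthogonal_orthogonal]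
      exact hx

/-- For i.i.d. Gaussian channel vectors, the squared norms of the projected vectors are independent,
and that of user `k` has the law of the squared norm of `dof M k` Gaussian coordinates: given
linearly independent earlier vectors, the next one is projected to a subspace of that dimension.
The test functions vanish at `0`, which discards linearly dependent vectors. -/
lemma lintegral_prod_projVec {M : ℕ} : ∀ {K : ℕ} (f : Fin K → ℝ → ℝ≥0∞),
    (∀ k, Measurable (f k)) → (∀ k, f k 0 = 0) →
    ∫⁻ h : Channel K M, ∏ k, f k (‖projVec h k‖ ^ 2)
        ∂(Measure.pi fun _ : Fin K => gaussianVector M) =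
      ∏ k, ∫⁻ x, f k (headNormSq (dof M k) x) ∂gaussianVector M := by
  intro K
  induction K with
  | zero => intro f _ _; simp
  | succ K ih =>
    intro f hf h0
    have hmeas : ∀ {L : ℕ} (g : Fin L → ℝ → ℝ≥0∞), (∀ k, Measurable (g k)) →
        Measurable fun h : Channel L M => ∏ k, g k (‖projVec h k‖ ^ 2) := fun g hg =>
      Finset.measurable_fun_prod _ fun k _ => (hg k).comp ((measurable_projVec k).norm.pow_const 2)
    have hmp := (measurePreserving_piFinSuccAbove
      (fun _ : Fin (K + 1) => gaussianVector M) (Fin.last K)).symm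
    rw [← hmp.lintegral_comp (hmeas f hf)]
    refine (lintegral_prod_symm' _ ((hmeas f hf).comp (MeasurableEquiv.measurable _))).trans ?_
    simp only [Function.comp_apply]
    have hsnoc : ∀ (x : EuclideanSpace ℂ (Fin M)) (h : Channel K M),
        (MeasurableEquiv.piFinSuccAbove (fun _ => EuclideanSpace ℂ (Fin M)) (Fin.last K)).symm
          (x, h) = (Fin.snoc h x : Channel (K + 1) M) := fun x h => by
      exact Fin.insertNth_last' x h
    have hinner : ∀ h : Channel K M,
        ∫⁻ x, ∏ k, f k (‖projVec ((MeasurableEquiv.piFinSuccAbove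
            (fun _ => EuclideanSpace ℂ (Fin M)) (Fin.last K)).symm (x, h)) k‖ ^ 2)
            ∂gaussianVector M =
          (∏ k : Fin K, f k.castSucc (‖projVec h k‖ ^ 2)) *
            ∫⁻ x, f (Fin.last K) (headNormSq (dof M (Fin.last K)) x) ∂gaussianVector M := by
      intro h
      simp_rw [hsnoc, Fin.prod_univ_castSucc, projVec_snoc_castSucc, projVec_snoc_last]
      have hm : Measurable fun x : EuclideanSpace ℂ (Fin M) => f (Fin.last K)
          (‖(Submodule.span ℂ (Set.range h))ᗮ.starProjection x‖ ^ 2) :=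
        (hf _).comp ((ContinuousLinearMap.continuous _).norm.pow 2).measurable
      rw [lintegral_const_mul _ hm]
      by_cases hz : ∃ k, projVec h k = 0
      · obtain ⟨k, hk⟩ := hz
        rw [Finset.prod_eq_zero (Finset.mem_univ k) (by simp [hk, h0]), zero_mul, zero_mul]
      · push Not at hz
        have hli := linearIndependent_of_projVec_ne_zero h hz
        have hfr : Module.finrank ℂ ((Submodule.span ℂ (Set.range h))ᗮ : Submodule ℂ _) =
            dof M (Fin.last K) := by
          have h1 := (Submodule.span ℂ (Set.range h)).finrank_add_finrank_orthogonal
          rw [finrank_span_eq_card hli, finrank_euclideanSpace, Fintype.card_fin,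
            Fintype.card_fin] at h1
          simp only [dof, Fin.val_last]
          omega
        rw [lintegral_norm_starProjection_sq _ hfr _ (hf _)]
    simp_rw [hinner]
    rw [lintegral_mul_const _ (hmeas (fun k : Fin K => f k.castSucc) fun k => hf _),
      ih (fun k => f k.castSucc) (fun k => hf _) (fun k => h0 _), Fin.prod_univ_castSucc]
    rfl

/-- The law of the channel matrix, as a product over the users. -/
lemma map_channel {Ω : Type*} [MeasurableSpace Ω] (P : Measure Ω) [IsProbabilityMeasure P]
    {K M : ℕ} (H : Ω → Channel K M) (hmeas : ∀ k m, Measurable fun ω => H ω k m)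
    (hindep : iIndepFun (fun (p : Fin K × Fin M) (ω : Ω) => H ω p.1 p.2) P)
    (hlaw : ∀ k m, P.map (fun ω => H ω k m) = complexGaussian) :
    Measurable H ∧ P.map H = Measure.pi fun _ : Fin K => gaussianVector M := by
  have hH : ∀ ω, H ω = fun k => WithLp.toLp 2 (fun m => H ω k m) := fun ω => rfl
  have htoLp : Measurable (WithLp.toLp 2 : (Fin M → ℂ) → EuclideanSpace ℂ (Fin M)) :=
    (MeasurableEquiv.toLp 2 (Fin M → ℂ)).measurable
  have hH0 : Measurable fun ω => fun (k : Fin K) (m : Fin M) => H ω k m :=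
    measurable_pi_lambda _ fun k => measurable_pi_lambda _ fun m => hmeas k m
  have hcoord : Measurable fun (g : Fin K → Fin M → ℂ) (k : Fin K) =>
      (WithLp.toLp 2 (g k) : EuclideanSpace ℂ (Fin M)) :=
    measurable_pi_lambda _ fun k => htoLp.comp (measurable_pi_apply k)
  have hHm : Measurable H := hcoord.comp hH0
  refine ⟨hHm, ?_⟩
  have h1 := hindep.map_fun_eq_pi_map fun p : Fin K × Fin M => (hmeas p.1 p.2).aemeasurable
  simp_rw [hlaw] at h1
  have h2 := Measure.infinitePi_map_curry
    (μ := fun (_ : Fin K) (_ : Fin M) => complexGaussian)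
  simp_rw [Measure.infinitePi_eq_pi] at h2
  rw [← h1, Measure.map_map (MeasurableEquiv.measurable _)
    (measurable_pi_lambda _ fun p : Fin K × Fin M => hmeas p.1 p.2)] at h2
  have h3 := Measure.pi_map_pi (μ := fun _ : Fin K => Measure.pi fun _ : Fin M => complexGaussian)
    (f := fun _ => (WithLp.toLp 2 : (Fin M → ℂ) → EuclideanSpace ℂ (Fin M)))
    (fun _ => htoLp.aemeasurable)
  rw [← h2, Measure.map_map hcoord ((MeasurableEquiv.measurable _).comp
    (measurable_pi_lambda _ fun p : Fin K × Fin M => hmeas p.1 p.2))] at h3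
  exact h3

/-! ### Moments and small balls of the Gaussian vector -/

lemma gaussianReal_half_le_volume : gaussianReal 0 (1 / 2) ≤ volume := by
  rw [gaussianReal_of_var_ne_zero 0 (by norm_num)]
  refine (withDensity_mono (g := 1) (Eventually.of_forall fun x => ?_)).trans_eq withDensity_one
  rw [gaussianPDF, Pi.one_apply, ENNReal.ofReal_le_one, gaussianPDFReal]
  have h1 : (1 : ℝ) ≤ √(2 * Real.pi * ((1 / 2 : NNReal) : ℝ)) := by
    rw [Real.one_le_sqrt]
    push_cast
    linarith [Real.pi_gt_three]
  have h2 : Real.exp (-(x - 0) ^ 2 / (2 * ((1 / 2 : NNReal) : ℝ))) ≤ 1 := by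
    rw [Real.exp_le_one_iff]
    push_cast
    have := sq_nonneg (x - 0)
    linarith
  exact mul_le_one₀ (inv_le_one_of_one_le₀ h1) (Real.exp_pos _).le h2

lemma lintegral_enorm_rpow_neg_Icc_lt_top {b : ℝ} (hb : b < 1) :
    ∫⁻ x in Set.Icc (-1 : ℝ) 1, ‖x‖ₑ ^ (-b) < ∞ := by
  have h1 : IntervalIntegrable (fun x : ℝ => x ^ (-b)) volume 0 1 :=
    intervalIntegral.intervalIntegrable_rpow' (by linarith)
  have h2 : IntervalIntegrable (fun x : ℝ => |x| ^ (-b)) volume 0 1 := by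
    refine h1.congr fun x hx => ?_
    rw [Set.uIoc_of_le zero_le_one] at hx
    simp only [abs_of_pos hx.1]
  have h3 : IntervalIntegrable (fun x : ℝ => |x| ^ (-b)) volume (-1) 0 := by
    have := (h2.comp_sub_left 0).symm
    simpa using this
  have h4 := (h3.trans h2).1
  rw [← integrableOn_Icc_iff_integrableOn_Ioc] at h4
  refine lt_of_eq_of_lt (lintegral_congr_ae ?_) h4.lintegral_lt_top
  have h5 : ∀ᵐ x : ℝ ∂volume.restrict (Set.Icc (-1 : ℝ) 1), x ≠ 0 :=
    ae_restrict_of_ae (Measure.ae_ne volume 0)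
  filter_upwards [h5] with x hx
  rw [← ofReal_norm, Real.norm_eq_abs, ENNReal.ofReal_rpow_of_pos (abs_pos.2 hx)]

lemma lintegral_enorm_rpow_neg_gaussianReal_lt_top {b : ℝ} (hb0 : 0 ≤ b) (hb : b < 1) :
    ∫⁻ x, ‖x‖ₑ ^ (-b) ∂gaussianReal 0 (1 / 2) < ∞ := by
  rw [← lintegral_add_compl _ (measurableSet_Icc : MeasurableSet (Set.Icc (-1 : ℝ) 1))]
  refine ENNReal.add_lt_top.2 ⟨?_, ?_⟩
  · refine lt_of_le_of_lt (lintegral_mono' (Measure.restrict_mono le_rfl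
      gaussianReal_half_le_volume) le_rfl) (lintegral_enorm_rpow_neg_Icc_lt_top hb)
  · refine lt_of_le_of_lt (setLIntegral_mono (g := fun _ => 1) measurable_const fun x hx => ?_) ?_
    · have h1 : 1 ≤ ‖x‖ₑ := by
        rw [← ofReal_norm, ENNReal.one_le_ofReal, Real.norm_eq_abs]
        by_contra hlt
        exact hx (abs_le.1 (not_le.1 hlt).le)
      rw [ENNReal.rpow_neg]
      exact ENNReal.inv_le_one.2 ((ENNReal.one_rpow b).symm.le.trans (ENNReal.rpow_le_rpow h1 hb0))
    · rw [setLIntegral_one]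
      exact measure_lt_top _ _

lemma lintegral_enorm_sq_rpow_neg_complexGaussian_lt_top {b : ℝ} (hb0 : 0 ≤ b) (hb : b < 1) :
    ∫⁻ z, (‖z‖ₑ ^ 2) ^ (-b) ∂complexGaussian < ∞ := by
  rw [lintegral_complexGaussian]
  calc ∫⁻ p : ℝ × ℝ, (‖(⟨p.1, p.2⟩ : ℂ)‖ₑ ^ 2) ^ (-b)
        ∂(gaussianReal 0 (1 / 2)).prod (gaussianReal 0 (1 / 2))
      ≤ ∫⁻ p : ℝ × ℝ, ‖p.1‖ₑ ^ (-b) * ‖p.2‖ₑ ^ (-b)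
        ∂(gaussianReal 0 (1 / 2)).prod (gaussianReal 0 (1 / 2)) := by
        refine lintegral_mono fun p => ?_
        simp only [ENNReal.rpow_neg]
        rw [← ENNReal.mul_inv, ENNReal.inv_le_inv, sq,
          ENNReal.mul_rpow_of_nonneg _ _ hb0]
        · refine mul_le_mul' (ENNReal.rpow_le_rpow ?_ hb0) (ENNReal.rpow_le_rpow ?_ hb0)
          · rw [← ofReal_norm, ← ofReal_norm]
            exact ENNReal.ofReal_le_ofReal (Complex.abs_re_le_norm ⟨p.1, p.2⟩)
          · rw [← ofReal_norm, ← ofReal_norm]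
            exact ENNReal.ofReal_le_ofReal (Complex.abs_im_le_norm ⟨p.1, p.2⟩)
        · exact Or.inr (ENNReal.rpow_ne_top_of_nonneg hb0 enorm_ne_top)
        · exact Or.inl (ENNReal.rpow_ne_top_of_nonneg hb0 enorm_ne_top)
    _ = (∫⁻ x, ‖x‖ₑ ^ (-b) ∂gaussianReal 0 (1 / 2)) * ∫⁻ x, ‖x‖ₑ ^ (-b) ∂gaussianReal 0 (1 / 2) :=
        lintegral_prod_mul (f := fun x : ℝ => ‖x‖ₑ ^ (-b)) (g := fun x : ℝ => ‖x‖ₑ ^ (-b))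
          (by fun_prop) (by fun_prop)
    _ < ∞ := ENNReal.mul_lt_top (lintegral_enorm_rpow_neg_gaussianReal_lt_top hb0 hb)
        (lintegral_enorm_rpow_neg_gaussianReal_lt_top hb0 hb)

lemma exists_le_gaussianReal_Ioc :
    ∃ c > 0, ∀ w : ℝ, 0 ≤ w → w ≤ 1 →
      ENNReal.ofReal (c * w) ≤ gaussianReal 0 (1 / 2) (Set.Ioc 0 w) := by
  -- the density is smallest at the right end of `(0, 1]`
  refine ⟨gaussianPDFReal 0 (1 / 2) 1, gaussianPDFReal_pos 0 (1 / 2) 1 (by norm_num),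
    fun w hw0 hw1 => ?_⟩
  rw [gaussianReal_apply 0 (by norm_num)]
  calc ENNReal.ofReal (gaussianPDFReal 0 (1 / 2) 1 * w)
      = ∫⁻ _ in Set.Ioc 0 w, ENNReal.ofReal (gaussianPDFReal 0 (1 / 2) 1) := by
        rw [setLIntegral_const, Real.volume_Ioc, sub_zero,
          ENNReal.ofReal_mul (gaussianPDFReal_nonneg _ _ _)]
    _ ≤ _ := by
        refine setLIntegral_mono (measurable_gaussianPDF 0 (1 / 2)) fun x hx => ?_
        refine ENNReal.ofReal_le_ofReal ?_
        unfold gaussianPDFReal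
        refine mul_le_mul_of_nonneg_left (Real.exp_le_exp.2 ?_) (by positivity)
        push_cast
        have := hx.1
        have := hx.2
        nlinarith

lemma exists_le_complexGaussian_ball :
    ∃ c > 0, ∀ u : ℝ, 0 ≤ u → u ≤ 1 →
      ENNReal.ofReal (c * u) ≤ complexGaussian {z | 0 < ‖z‖ ^ 2 ∧ ‖z‖ ^ 2 ≤ u} := by
  obtain ⟨c, hc, h⟩ := exists_le_gaussianReal_Ioc
  -- the disc of squared radius `u` contains a square of side `√(u / 2)`
  refine ⟨c ^ 2 / 2, by positivity, fun u hu0 hu1 => ?_⟩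
  have hmeas : MeasurableSet {z : ℂ | 0 < ‖z‖ ^ 2 ∧ ‖z‖ ^ 2 ≤ u} :=
    (measurable_norm.pow_const 2) measurableSet_Ioc
  have hw : √(u / 2) ≤ 1 := Real.sqrt_le_one.2 (by linarith)
  calc ENNReal.ofReal (c ^ 2 / 2 * u)
      = ENNReal.ofReal (c * √(u / 2)) * ENNReal.ofReal (c * √(u / 2)) := by
        rw [← ENNReal.ofReal_mul (by positivity)]
        congr 1
        have := Real.mul_self_sqrt (show 0 ≤ u / 2 by positivity)
        linear_combination (-c ^ 2) * this
    _ ≤ gaussianReal 0 (1 / 2) (Set.Ioc 0 √(u / 2)) * gaussianReal 0 (1 / 2) (Set.Ioc 0 √(u / 2)) :=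
        mul_le_mul' (h _ (Real.sqrt_nonneg _) hw) (h _ (Real.sqrt_nonneg _) hw)
    _ = (gaussianReal 0 (1 / 2)).prod (gaussianReal 0 (1 / 2))
          (Set.Ioc 0 √(u / 2) ×ˢ Set.Ioc 0 √(u / 2)) := (Measure.prod_prod _ _).symm
    _ ≤ (gaussianReal 0 (1 / 2)).prod (gaussianReal 0 (1 / 2))
          (Complex.measurableEquivRealProd.symm ⁻¹' {z | 0 < ‖z‖ ^ 2 ∧ ‖z‖ ^ 2 ≤ u}) := by
        refine measure_mono ?_
        rintro ⟨x, y⟩ ⟨⟨hx0, hx⟩, ⟨hy0, hy⟩⟩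
        have hz : ‖(⟨x, y⟩ : ℂ)‖ ^ 2 = x * x + y * y := by
          rw [← Complex.normSq_eq_norm_sq, Complex.normSq_apply]
        simp only at hx0 hx hy0 hy
        have hxx := (Real.le_sqrt' hx0).1 hx
        have hyy := (Real.le_sqrt' hy0).1 hy
        change 0 < ‖(⟨x, y⟩ : ℂ)‖ ^ 2 ∧ ‖(⟨x, y⟩ : ℂ)‖ ^ 2 ≤ u
        rw [hz]
        constructor <;> nlinarith
    _ = complexGaussian {z | 0 < ‖z‖ ^ 2 ∧ ‖z‖ ^ 2 ≤ u} :=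
        (Measure.map_apply Complex.measurableEquivRealProd.symm.measurable hmeas).symm

lemma complexGaussian_singleton_zero : complexGaussian {0} = 0 := by
  have hpre : Complex.measurableEquivRealProd.symm ⁻¹' {0} = {((0, 0) : ℝ × ℝ)} := by
    ext ⟨x, y⟩
    change (⟨x, y⟩ : ℂ) = 0 ↔ _
    simp [Complex.ext_iff]
  have h := Measure.map_apply (μ := (gaussianReal 0 (1 / 2)).prod (gaussianReal 0 (1 / 2)))
    Complex.measurableEquivRealProd.symm.measurable (measurableSet_singleton (0 : ℂ))
  rw [hpre, ← Set.singleton_prod_singleton, Measure.prod_prod] at h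
  have : NullSingletonClass (gaussianReal 0 (1 / 2)) :=
    nullSingletonClass_gaussianReal (by norm_num)
  rw [measure_singleton (μ := gaussianReal 0 (1 / 2)) 0, zero_mul] at h
  exact h

/-- The first `n` coordinates of a Gaussian vector are i.i.d. -/
lemma lintegral_prod_head {M n : ℕ} (hn : n ≤ M) (g : ℂ → ℝ≥0∞) (hg : Measurable g) :
    ∫⁻ x : EuclideanSpace ℂ (Fin M), ∏ i : Fin M with i.val < n, g (x i) ∂gaussianVector M =
      (∫⁻ z, g z ∂complexGaussian) ^ n := by
  have hind : iIndepFun (fun (i : Fin M) (x : Fin M → ℂ) => g (x i))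
      (Measure.pi fun _ : Fin M => complexGaussian) := iIndepFun_pi fun _ => hg.aemeasurable
  have h1 := lintegral_prod_eq_prod_lintegral_of_indepFun
    (Finset.univ.filter fun i : Fin M => i.val < n) _ hind
    (fun i => hg.comp (measurable_pi_apply i))
  have h2 : ∀ i : Fin M, ∫⁻ x : Fin M → ℂ, g (x i) ∂(Measure.pi fun _ : Fin M => complexGaussian) =
      ∫⁻ z, g z ∂complexGaussian := fun i =>
    (measurePreserving_eval (fun _ : Fin M => complexGaussian) i).lintegral_comp hg
  simp_rw [h2] at h1
  rw [Finset.prod_const, Fin.card_filter_val_lt, min_eq_right hn] at h1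
  rw [← h1]
  exact lintegral_map_equiv
    (fun x : EuclideanSpace ℂ (Fin M) => ∏ i : Fin M with i.val < n, g (x i))
    (MeasurableEquiv.toLp 2 (Fin M → ℂ))

lemma sq_norm_le_headNormSq {M n : ℕ} (x : EuclideanSpace ℂ (Fin M)) {i : Fin M}
    (hi : i.val < n) : ‖x i‖ ^ 2 ≤ headNormSq n x :=
  Finset.single_le_sum (f := fun i => ‖x i‖ ^ 2) (fun _ _ => by positivity)
    (Finset.mem_filter.2 ⟨Finset.mem_univ i, hi⟩)

lemma headNormSq_nonneg {M : ℕ} (n : ℕ) (x : EuclideanSpace ℂ (Fin M)) : 0 ≤ headNormSq n x :=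
  Finset.sum_nonneg fun _ _ => by positivity

lemma headNormSq_ne_zero_ae {M n : ℕ} (hn : n ≤ M) (hn0 : n ≠ 0) :
    ∀ᵐ x ∂gaussianVector M, headNormSq n x ≠ 0 := by
  have h1 := lintegral_prod_head hn (Set.indicator {0} fun _ => 1)
    (measurable_const.indicator (measurableSet_singleton 0))
  rw [lintegral_indicator_const (measurableSet_singleton 0), complexGaussian_singleton_zero,
    mul_zero, zero_pow hn0, lintegral_eq_zero_iff] at h1
  · filter_upwards [h1] with x hx h0
    have hz : ∀ i : Fin M, i.val < n → x i = 0 := fun i hi => by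
      have := (sq_norm_le_headNormSq x hi).trans h0.le
      have := pow_eq_zero_iff (two_ne_zero) |>.1 (le_antisymm this (by positivity))
      exact norm_eq_zero.1 this
    rw [Finset.prod_eq_one] at hx
    · simp at hx
    · intro i hi
      simp [hz i (Finset.mem_filter.1 hi).2]
  · refine Finset.measurable_fun_prod _ fun i _ => ?_
    exact (measurable_const.indicator (measurableSet_singleton 0)).comp (by fun_prop)

/-- The squared norm `Y` of `n` Gaussian coordinates has `E (1 + c Y) ^ (-a) ≤ C c ^ (-a)` for
`a < n`: each coordinate bounds a factor `(1 + c Y) ^ (-a / n)`. -/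
lemma exists_lintegral_headNormSq_le {M n : ℕ} (hn : n ≤ M) (hn0 : n ≠ 0) {a : ℝ} (ha0 : 0 ≤ a)
    (ha : a < n) :
    ∃ C : ℝ≥0∞, C ≠ ∞ ∧ ∀ c : ℝ, 0 < c →
      ∫⁻ x : EuclideanSpace ℂ (Fin M), ENNReal.ofReal (1 + c * headNormSq n x) ^ (-a)
        ∂gaussianVector M ≤ ENNReal.ofReal (c ^ (-a)) * C := by
  have hnpos : (0 : ℝ) < n := by positivity
  set b : ℝ := a / n with hb
  have hb0 : 0 ≤ b := by positivity
  have hb1 : b < 1 := (div_lt_one hnpos).2 ha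
  refine ⟨(∫⁻ z, (‖z‖ₑ ^ 2) ^ (-b) ∂complexGaussian) ^ n,
    ENNReal.pow_ne_top (lintegral_enorm_sq_rpow_neg_complexGaussian_lt_top hb0 hb1).ne,
    fun c hc => ?_⟩
  have hcard : (Finset.univ.filter fun i : Fin M => i.val < n).card = n := by
    rw [Fin.card_filter_val_lt, min_eq_right hn]
  rw [← lintegral_prod_head hn _ (by fun_prop), ← lintegral_const_mul]
  · refine lintegral_mono fun x => ?_
    have hY := headNormSq_nonneg n x
    calc ENNReal.ofReal (1 + c * headNormSq n x) ^ (-a)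
        = ∏ _i : Fin M with _i.val < n, ENNReal.ofReal (1 + c * headNormSq n x) ^ (-b) := by
          rw [Finset.prod_const, hcard, ← ENNReal.rpow_natCast, ← ENNReal.rpow_mul, hb]
          congr 1
          field_simp
      _ ≤ ∏ i : Fin M with i.val < n, ENNReal.ofReal (c ^ (-b)) * (‖x i‖ₑ ^ 2) ^ (-b) := by
          refine Finset.prod_le_prod' fun i hi => ?_
          have hi := sq_norm_le_headNormSq x (Finset.mem_filter.1 hi).2
          have h1 : ENNReal.ofReal c * ‖x i‖ₑ ^ 2 ≤ ENNReal.ofReal (1 + c * headNormSq n x) := by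
            rw [← ofReal_norm, ← ENNReal.ofReal_pow (norm_nonneg _),
              ← ENNReal.ofReal_mul hc.le]
            exact ENNReal.ofReal_le_ofReal (by nlinarith)
          rw [← ENNReal.ofReal_rpow_of_pos hc, ← ENNReal.mul_rpow_of_ne_top ENNReal.ofReal_ne_top
            (by simp), ENNReal.rpow_neg, ENNReal.rpow_neg]
          exact ENNReal.inv_le_inv.2 (ENNReal.rpow_le_rpow h1 hb0)
      _ = ENNReal.ofReal (c ^ (-a)) * ∏ i : Fin M with i.val < n, (‖x i‖ₑ ^ 2) ^ (-b) := by
          rw [Finset.prod_mul_distrib, Finset.prod_const, hcard, ← ENNReal.ofReal_pow (by positivity),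
            ← Real.rpow_natCast, ← Real.rpow_mul hc.le, hb]
          congr 3
          field_simp
  · refine Finset.measurable_fun_prod _ fun i _ => ?_
    fun_prop

/-- The squared norm of `n` Gaussian coordinates is nonzero and at most `t ≤ 1` with probability at
least `c t ^ n`. -/
lemma exists_le_gaussianVector_headNormSq {M n : ℕ} (hn : n ≤ M) (hn0 : n ≠ 0) :
    ∃ c > 0, ∀ t : ℝ, 0 ≤ t → t ≤ 1 → ENNReal.ofReal (c * t ^ n) ≤
      gaussianVector M {x | headNormSq n x ≠ 0 ∧ headNormSq n x ≤ t} := by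
  obtain ⟨c, hc, h⟩ := exists_le_complexGaussian_ball
  have hnpos : (0 : ℝ) < n := by positivity
  have hn1 : (1 : ℝ) ≤ n := by exact_mod_cast Nat.one_le_iff_ne_zero.2 hn0
  refine ⟨(c / n) ^ n, by positivity, fun t ht0 ht1 => ?_⟩
  have hcard : (Finset.univ.filter fun i : Fin M => i.val < n).card = n := by
    rw [Fin.card_filter_val_lt, min_eq_right hn]
  have hmeas : MeasurableSet {z : ℂ | 0 < ‖z‖ ^ 2 ∧ ‖z‖ ^ 2 ≤ t / n} :=
    (measurable_norm.pow_const 2) measurableSet_Ioc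
  have hmeasY : MeasurableSet {x : EuclideanSpace ℂ (Fin M) |
      headNormSq n x ≠ 0 ∧ headNormSq n x ≤ t} :=
    (measurable_headNormSq n (measurableSet_singleton 0).compl).inter
      (measurable_headNormSq n measurableSet_Iic)
  have h1 := lintegral_prod_head hn (Set.indicator {z : ℂ | 0 < ‖z‖ ^ 2 ∧ ‖z‖ ^ 2 ≤ t / n}
    fun _ => 1) (measurable_const.indicator hmeas)
  rw [lintegral_indicator_const hmeas, one_mul] at h1
  calc ENNReal.ofReal ((c / n) ^ n * t ^ n) = ENNReal.ofReal (c * (t / n)) ^ n := by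
        rw [← ENNReal.ofReal_pow (by positivity), ← mul_pow]
        congr 2
        field_simp
    _ ≤ complexGaussian {z | 0 < ‖z‖ ^ 2 ∧ ‖z‖ ^ 2 ≤ t / n} ^ n :=
        pow_le_pow_left' (h _ (by positivity) (div_le_one_of_le₀ (ht1.trans hn1) hnpos.le)) n
    _ = _ := h1.symm
    _ ≤ ∫⁻ x, Set.indicator {x : EuclideanSpace ℂ (Fin M) |
          headNormSq n x ≠ 0 ∧ headNormSq n x ≤ t} (fun _ => 1) x ∂gaussianVector M := by
        refine lintegral_mono fun x => ?_
        by_cases hx : ∀ i : Fin M, i.val < n → 0 < ‖x i‖ ^ 2 ∧ ‖x i‖ ^ 2 ≤ t / n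
        · rw [Set.indicator_of_mem]
          · refine Finset.prod_le_one' fun i _ => Set.indicator_le' (fun _ _ => le_rfl)
              (fun _ _ => zero_le) _
          · refine ⟨?_, ?_⟩
            · have h0 : (⟨0, by omega⟩ : Fin M).val < n := Nat.pos_of_ne_zero hn0
              exact ((hx _ h0).1.trans_le (sq_norm_le_headNormSq x h0)).ne'
            · calc headNormSq n x ≤ ∑ _i : Fin M with _i.val < n, t / n :=
                  Finset.sum_le_sum fun i hi => (hx i (Finset.mem_filter.1 hi).2).2
                _ = t := by
                  rw [Finset.sum_const, hcard, nsmul_eq_mul]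
                  field_simp
        · push Not at hx
          obtain ⟨i, hi, hxi⟩ := hx
          rw [Finset.prod_eq_zero (Finset.mem_filter.2 ⟨Finset.mem_univ i, hi⟩)]
          · exact zero_le
          · exact Set.indicator_of_notMem (fun hm => absurd hm.2 (not_le.2 (hxi hm.1))) _
    _ = _ := by rw [lintegral_indicator_const hmeasY, one_mul]

/-! ### Joint bounds for the projected channel vectors -/

lemma dof_ne_zero {K M : ℕ} (hKM : K ≤ M) (k : Fin K) : dof M k ≠ 0 := by
  have := k.2
  unfold dof
  omega

lemma ae_projVec_ne_zero {K M : ℕ} (hKM : K ≤ M) :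
    ∀ᵐ h : Channel K M ∂(Measure.pi fun _ : Fin K => gaussianVector M), ∀ k, projVec h k ≠ 0 := by
  have hmeas : MeasurableSet {h : Channel K M | ∀ k, projVec h k ≠ 0} := by
    rw [Set.ofPred_forall]
    exact MeasurableSet.iInter fun k => measurable_projVec k (measurableSet_singleton 0).compl
  have h1 := lintegral_prod_projVec (M := M) (fun _ : Fin K => Set.indicator {0}ᶜ fun _ => 1)
    (fun _ => measurable_const.indicator (measurableSet_singleton 0).compl) (by simp)
  have h2 : ∀ k : Fin K, ∫⁻ x : EuclideanSpace ℂ (Fin M),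
      Set.indicator {0}ᶜ (fun _ => (1 : ℝ≥0∞)) (headNormSq (dof M k) x) ∂gaussianVector M = 1 := by
    intro k
    rw [lintegral_congr_ae (g := fun _ => 1), lintegral_one, measure_univ]
    filter_upwards [headNormSq_ne_zero_ae (Nat.sub_le M k) (dof_ne_zero hKM k)] with x hx
    exact Set.indicator_of_mem (s := {(0 : ℝ)}ᶜ) hx _
  simp_rw [h2, Finset.prod_const_one] at h1
  have h3 : ∀ h : Channel K M, ∏ k, Set.indicator {0}ᶜ (fun _ => (1 : ℝ≥0∞)) (‖projVec h k‖ ^ 2) =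
      Set.indicator {h : Channel K M | ∀ k, projVec h k ≠ 0} (fun _ => 1) h := by
    intro h
    by_cases hh : ∀ k, projVec h k ≠ 0
    · rw [Set.indicator_of_mem (show h ∈ {h : Channel K M | ∀ k, projVec h k ≠ 0} from hh)]
      refine Finset.prod_eq_one fun k _ => Set.indicator_of_mem ?_ _
      simpa using hh k
    · rw [Set.indicator_of_notMem (show h ∉ {h : Channel K M | ∀ k, projVec h k ≠ 0} from hh)]
      push Not at hh
      obtain ⟨k, hk⟩ := hh
      exact Finset.prod_eq_zero (Finset.mem_univ k) (by simp [hk])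
  simp_rw [h3] at h1
  rw [lintegral_indicator_const hmeas, one_mul] at h1
  exact (mem_ae_iff_prob_eq_one hmeas).2 h1

/-- Exponential form of the outage event, the pointwise inequality behind the Chernoff bound. -/
lemma propWeightedSumRate_exp_bound {K M : ℕ} {μ a : Fin K → ℝ} (hμ : ∀ k, 0 < μ k) {s : ℝ}
    (hs : 0 ≤ s) (has : ∀ k, a k ≤ s * μ k) {h : Channel K M} {ρ T : ℝ} (hρ : 0 < ρ)
    (hT : propWeightedSumRate μ h ρ ≤ T) :
    1 ≤ ENNReal.ofReal (Real.exp (s * T)) *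
      ∏ k, ENNReal.ofReal (1 + μ k * ρ * ‖projVec h k‖ ^ 2) ^ (-a k) := by
  have hge : ∀ k, 1 ≤ 1 + μ k * ρ * ‖projVec h k‖ ^ 2 := fun k => by
    have := hμ k
    have : 0 ≤ μ k * ρ * ‖projVec h k‖ ^ 2 := by positivity
    linarith
  have hpos : ∀ k, 0 < 1 + μ k * ρ * ‖projVec h k‖ ^ 2 := fun k => one_pos.trans_le (hge k)
  have h1 : ∏ k, ENNReal.ofReal (1 + μ k * ρ * ‖projVec h k‖ ^ 2) ^ (-a k) =
      ENNReal.ofReal (Real.exp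
        (∑ k, Real.log (1 + μ k * ρ * ‖projVec h k‖ ^ 2) * (-a k))) := by
    rw [Real.exp_sum, ENNReal.ofReal_prod_of_nonneg fun _ _ => (Real.exp_pos _).le]
    refine Finset.prod_congr rfl fun k _ => ?_
    rw [ENNReal.ofReal_rpow_of_pos (hpos k), Real.rpow_def_of_pos (hpos k)]
  rw [h1, ← ENNReal.ofReal_mul (Real.exp_pos _).le, ← Real.exp_add, ENNReal.one_le_ofReal,
    Real.one_le_exp_iff]
  have h2 : ∑ k, Real.log (1 + μ k * ρ * ‖projVec h k‖ ^ 2) * a k ≤ s * T := by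
    calc _ ≤ ∑ k, s * (μ k * Real.log (1 + μ k * ρ * ‖projVec h k‖ ^ 2)) := by
          refine Finset.sum_le_sum fun k _ => ?_
          have := mul_le_mul_of_nonneg_left (has k) (Real.log_nonneg (hge k))
          linarith
      _ = s * propWeightedSumRate μ h ρ := by rw [propWeightedSumRate, Finset.mul_sum]
      _ ≤ s * T := mul_le_mul_of_nonneg_left hT hs
  simp only [mul_neg, Finset.sum_neg_distrib]
  linarith

/-- Chernoff bound for the outage event. -/
lemma exists_propWeightedSumRate_le {K M : ℕ} (hKM : K ≤ M) {μ a : Fin K → ℝ}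
    (hμ : ∀ k, 0 < μ k) {s : ℝ} (hs : 0 ≤ s) (ha0 : ∀ k, 0 ≤ a k) (han : ∀ k, a k < dof M k)
    (has : ∀ k, a k ≤ s * μ k) :
    ∃ C > 0, ∀ ρ > 0, ∀ T : ℝ,
      (Measure.pi fun _ : Fin K => gaussianVector M).real {h | propWeightedSumRate μ h ρ ≤ T} ≤
        C * (Real.exp (s * T) * ρ ^ (-∑ k, a k)) := by
  choose C hC hbound using fun k : Fin K =>
    exists_lintegral_headNormSq_le (Nat.sub_le M k) (dof_ne_zero hKM k) (ha0 k) (han k)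
  refine ⟨(∏ k, μ k ^ (-a k)) * (∏ k, C k).toReal + 1, by
    have : 0 ≤ ∏ k, μ k ^ (-a k) := Finset.prod_nonneg fun k _ => Real.rpow_nonneg (hμ k).le _
    positivity, fun ρ hρ T => ?_⟩
  have hCtop : ∏ k, C k ≠ ∞ := ENNReal.prod_ne_top fun k _ => hC k
  set ν := Measure.pi fun _ : Fin K => gaussianVector M with hν
  -- test functions cut off at `0`, which is a null event for every user
  let f : Fin K → ℝ → ℝ≥0∞ := fun k =>
    Set.indicator {0}ᶜ fun y => ENNReal.ofReal (1 + μ k * ρ * y) ^ (-a k)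
  have hf : ∀ k, Measurable (f k) := fun k =>
    Measurable.indicator (by fun_prop) (measurableSet_singleton 0).compl
  have hF : Measurable fun h : Channel K M => ∏ k, f k (‖projVec h k‖ ^ 2) :=
    Finset.measurable_fun_prod _ fun k _ =>
      (hf k).comp ((measurable_projVec k).norm.pow_const 2)
  have h1 : ν {h | propWeightedSumRate μ h ρ ≤ T} ≤
      ν {h | 1 ≤ ENNReal.ofReal (Real.exp (s * T)) * ∏ k, f k (‖projVec h k‖ ^ 2)} := by
    refine measure_mono_ae ?_
    filter_upwards [ae_projVec_ne_zero hKM] with h hne hT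
    have h2 := propWeightedSumRate_exp_bound hμ hs has hρ hT
    have h3 : ∀ k, f k (‖projVec h k‖ ^ 2) =
        ENNReal.ofReal (1 + μ k * ρ * ‖projVec h k‖ ^ 2) ^ (-a k) := fun k =>
      Set.indicator_of_mem (by simpa using hne k) _
    simp_rw [← h3] at h2
    exact h2
  have h2 : ν {h | propWeightedSumRate μ h ρ ≤ T} ≤ ENNReal.ofReal (Real.exp (s * T)) *
      ∏ k, (ENNReal.ofReal ((μ k * ρ) ^ (-a k)) * C k) := by
    calc _ ≤ _ := h1
      _ ≤ ∫⁻ h, ENNReal.ofReal (Real.exp (s * T)) * ∏ k, f k (‖projVec h k‖ ^ 2) ∂ν := by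
          have := mul_meas_ge_le_lintegral (μ := ν)
            (hF.const_mul (ENNReal.ofReal (Real.exp (s * T)))) 1
          rwa [one_mul] at this
      _ = ENNReal.ofReal (Real.exp (s * T)) *
          ∏ k, ∫⁻ x, f k (headNormSq (dof M k) x) ∂gaussianVector M := by
          rw [lintegral_const_mul _ hF, hν,
            lintegral_prod_projVec f hf (fun k => by simp [f])]
      _ ≤ _ := by
          gcongr with k
          exact (lintegral_mono fun x => Set.indicator_le_self' (fun _ _ => zero_le) _).trans
            (hbound k _ (mul_pos (hμ k) hρ))
  have h3 : ENNReal.ofReal (Real.exp (s * T)) * ∏ k, (ENNReal.ofReal ((μ k * ρ) ^ (-a k)) * C k) =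
      ENNReal.ofReal ((∏ k, μ k ^ (-a k)) * (∏ k, C k).toReal *
        (Real.exp (s * T) * ρ ^ (-∑ k, a k))) := by
    have h4 : ∏ k, (μ k * ρ) ^ (-a k) = (∏ k, μ k ^ (-a k)) * ρ ^ (-∑ k, a k) := by
      rw [← Finset.sum_neg_distrib, Real.rpow_sum_of_pos hρ, ← Finset.prod_mul_distrib]
      exact Finset.prod_congr rfl fun k _ => Real.mul_rpow (hμ k).le hρ.le
    have h5 : 0 ≤ ∏ k, (μ k * ρ) ^ (-a k) := Finset.prod_nonneg fun k _ =>
      Real.rpow_nonneg (mul_pos (hμ k) hρ).le _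
    rw [Finset.prod_mul_distrib, ← ENNReal.ofReal_prod_of_nonneg
      (fun k _ => Real.rpow_nonneg (mul_pos (hμ k) hρ).le _), ← ENNReal.ofReal_toReal hCtop,
      ← ENNReal.ofReal_mul h5, ← ENNReal.ofReal_mul (Real.exp_pos _).le, h4,
      ENNReal.toReal_ofReal ENNReal.toReal_nonneg]
    congr 1
    ring
  have h6 : 0 ≤ ∏ k, μ k ^ (-a k) := Finset.prod_nonneg fun k _ => Real.rpow_nonneg (hμ k).le _
  rw [h3] at h2
  refine (ENNReal.toReal_le_of_le_ofReal (by positivity) h2).trans ?_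
  have : 0 ≤ Real.exp (s * T) * ρ ^ (-∑ k, a k) := by positivity
  linarith

/-- Small-ball lower bound for the projected channel vectors. -/
lemma exists_le_forall_projVec_le {K M : ℕ} (hKM : K ≤ M) :
    ∃ c > 0, ∀ t : Fin K → ℝ, (∀ k, 0 ≤ t k) → (∀ k, t k ≤ 1) →
      c * ∏ k, t k ^ dof M k ≤
        (Measure.pi fun _ : Fin K => gaussianVector M).real
          {h | ∀ k, ‖projVec h k‖ ^ 2 ≤ t k} := by
  choose c hc hbound using fun k : Fin K =>
    exists_le_gaussianVector_headNormSq (Nat.sub_le M k) (dof_ne_zero hKM k)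
  refine ⟨∏ k, c k, Finset.prod_pos fun k _ => hc k, fun t ht0 ht1 => ?_⟩
  set ν := Measure.pi fun _ : Fin K => gaussianVector M with hν
  have hmeas : MeasurableSet {h : Channel K M | ∀ k, ‖projVec h k‖ ^ 2 ≤ t k} := by
    rw [Set.ofPred_forall]
    exact MeasurableSet.iInter fun k =>
      ((measurable_projVec k).norm.pow_const 2) measurableSet_Iic
  have hS : ∀ k, MeasurableSet {y : ℝ | y ≠ 0 ∧ y ≤ t k} := fun k =>
    (measurableSet_singleton 0).compl.inter measurableSet_Iic
  have h1 := lintegral_prod_projVec (M := M)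
    (fun k : Fin K => Set.indicator {y : ℝ | y ≠ 0 ∧ y ≤ t k} fun _ => 1)
    (fun k => measurable_const.indicator (hS k)) (by simp)
  have h2 : ∏ k, ENNReal.ofReal (c k * t k ^ dof M k) ≤
      ν {h | ∀ k, ‖projVec h k‖ ^ 2 ≤ t k} := by
    calc ∏ k, ENNReal.ofReal (c k * t k ^ dof M k)
        ≤ ∏ k, ∫⁻ x : EuclideanSpace ℂ (Fin M), Set.indicator {y : ℝ | y ≠ 0 ∧ y ≤ t k}
            (fun _ => (1 : ℝ≥0∞)) (headNormSq (dof M k) x) ∂gaussianVector M := by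
          refine Finset.prod_le_prod' fun k _ => (hbound k (t k) (ht0 k) (ht1 k)).trans_eq ?_
          have := lintegral_indicator_const (μ := gaussianVector M)
            (measurable_headNormSq (M := M) (dof M k) (hS k)) 1
          rw [one_mul] at this
          exact this.symm
      _ = _ := h1.symm
      _ ≤ ∫⁻ h, Set.indicator {h : Channel K M | ∀ k, ‖projVec h k‖ ^ 2 ≤ t k} (fun _ => 1) h
            ∂ν := by
          refine lintegral_mono fun h => ?_
          by_cases hh : ∀ k, ‖projVec h k‖ ^ 2 ≤ t k
          · rw [Set.indicator_of_mem (show h ∈ {h : Channel K M | ∀ k, ‖projVec h k‖ ^ 2 ≤ t k}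
              from hh)]
            exact Finset.prod_le_one' fun k _ => Set.indicator_le' (fun _ _ => le_rfl)
              (fun _ _ => zero_le) _
          · push Not at hh
            obtain ⟨k, hk⟩ := hh
            rw [Finset.prod_eq_zero (Finset.mem_univ k)]
            · exact zero_le
            · exact Set.indicator_of_notMem (fun hm => absurd hm.2 (not_le.2 hk)) _
      _ = _ := by rw [lintegral_indicator_const hmeas, one_mul]
  rw [← ENNReal.ofReal_prod_of_nonneg fun k _ => mul_nonneg (hc k).le (pow_nonneg (ht0 k) _),
    ENNReal.ofReal_le_iff_le_toReal (measure_ne_top _ _), Finset.prod_mul_distrib] at h2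
  exact h2

/-! ### Weighted sum rates of the precoders -/

/-- Entrywise complex conjugate of a vector. -/
noncomputable def conjVec {M : ℕ} (w : EuclideanSpace ℂ (Fin M)) : EuclideanSpace ℂ (Fin M) :=
  WithLp.toLp 2 fun m => (starRingEnd ℂ) (w m)

lemma norm_conjVec {M : ℕ} (w : EuclideanSpace ℂ (Fin M)) : ‖conjVec w‖ = ‖w‖ := by
  simp [EuclideanSpace.norm_eq, conjVec]

lemma conjVec_conjVec {M : ℕ} (w : EuclideanSpace ℂ (Fin M)) : conjVec (conjVec w) = w := by
  ext m
  simp [conjVec]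

lemma received_eq_inner {M : ℕ} (h w : EuclideanSpace ℂ (Fin M)) :
    received h w = inner ℂ (conjVec w) h := by
  simp [received, PiLp.inner_apply, conjVec]

lemma inner_eq_inner_projVec {K M : ℕ} (h : Channel K M) (k : Fin K)
    (v : EuclideanSpace ℂ (Fin M)) (hv : ∀ j < k, inner ℂ v (h j) = 0) :
    inner ℂ v (h k) = inner ℂ v (projVec h k) := by
  have hmem : v ∈ (Submodule.span ℂ (h '' {j | j < k}))ᗮ := by
    rw [Submodule.mem_orthogonal']
    intro u hu
    induction hu using Submodule.span_induction with
    | mem x hx =>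
      obtain ⟨j, hj, rfl⟩ := hx
      exact hv j hj
    | zero => simp
    | add x y _ _ hx hy => rw [inner_add_right, hx, hy, add_zero]
    | smul a x _ hx => rw [inner_smul_right, hx, mul_zero]
  rw [projVec, ← Submodule.inner_starProjection_left_eq_right,
    Submodule.starProjection_eq_self_iff.2 hmem]

lemma inner_projVec_eq_zero {K M : ℕ} (h : Channel K M) {i j : Fin K} (hij : i < j) :
    inner ℂ (projVec h j) (h i) = 0 := by
  rw [projVec_eq_gramSchmidt]
  exact InnerProductSpace.gramSchmidt_inv_triangular ℂ h hij

lemma inner_projVec_self {K M : ℕ} (h : Channel K M) (k : Fin K) :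
    inner ℂ (projVec h k) (h k) = (‖projVec h k‖ : ℂ) ^ 2 := by
  rw [inner_eq_inner_projVec h k _ fun j hj => inner_projVec_eq_zero h hj]
  exact inner_self_eq_norm_sq_to_K _

lemma dpcSINR_of_isDPCPrecoder {K M : ℕ} {h : Channel K M} {ρ : ℝ}
    {w : Fin K → EuclideanSpace ℂ (Fin M)} (hw : IsDPCPrecoder h ρ w) (k : Fin K) :
    dpcSINR h w k = ‖received (h k) (w k)‖ ^ 2 := by
  rw [dpcSINR, Finset.sum_eq_zero, add_zero, div_one]
  intro j hj
  rw [hw.2 k j (Finset.mem_filter.1 hj).2]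
  simp

lemma dpcRate_le {K M : ℕ} {h : Channel K M} {ρ : ℝ}
    {w : Fin K → EuclideanSpace ℂ (Fin M)} (hw : IsDPCPrecoder h ρ w) (k : Fin K) :
    dpcRate h w k ≤ Real.log (1 + ρ * ‖projVec h k‖ ^ 2) := by
  have h1 : ‖received (h k) (w k)‖ ≤ ‖w k‖ * ‖projVec h k‖ := by
    rw [received_eq_inner, inner_eq_inner_projVec, ← norm_conjVec (w k)]
    · exact norm_inner_le_norm _ _
    · intro j hj
      rw [← received_eq_inner]
      exact hw.2 j k hj
  have h2 : ‖w k‖ ^ 2 ≤ ρ := (Finset.single_le_sum (f := fun k => ‖w k‖ ^ 2)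
    (fun _ _ => by positivity) (Finset.mem_univ k)).trans hw.1
  rw [dpcRate, dpcSINR_of_isDPCPrecoder hw]
  refine Real.log_le_log (by positivity) ?_
  have h3 : ‖received (h k) (w k)‖ ^ 2 ≤ (‖w k‖ * ‖projVec h k‖) ^ 2 :=
    pow_le_pow_left₀ (norm_nonneg _) h1 2
  have h4 := mul_le_mul_of_nonneg_right h2 (sq_nonneg ‖projVec h k‖)
  rw [mul_pow] at h3
  linarith

lemma sum_dpcRate_le {K M : ℕ} {μ : Fin K → ℝ} (hμ : ∀ k, 0 < μ k) {h : Channel K M} {ρ : ℝ}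
    {w : Fin K → EuclideanSpace ℂ (Fin M)} (hw : IsDPCPrecoder h ρ w) :
    ∑ k, μ k * dpcRate h w k ≤ ∑ k, μ k * Real.log (1 + ρ * ‖projVec h k‖ ^ 2) :=
  Finset.sum_le_sum fun k _ => mul_le_mul_of_nonneg_left (dpcRate_le hw k) (hμ k).le

lemma isDPCPrecoder_zero {K M : ℕ} (h : Channel K M) {ρ : ℝ} (hρ : 0 ≤ ρ) :
    IsDPCPrecoder h ρ fun _ => 0 := by
  refine ⟨by simpa using hρ, fun i j _ => by simp [received]⟩

/-- Every user gets at most the rate that it would have with all the power. -/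
lemma maxWeightedSumRate_le {K M : ℕ} {μ : Fin K → ℝ} (hμ : ∀ k, 0 < μ k) (h : Channel K M)
    {ρ : ℝ} (hρ : 0 ≤ ρ) :
    maxWeightedSumRate μ h ρ ≤ ∑ k, μ k * Real.log (1 + ρ * ‖projVec h k‖ ^ 2) := by
  refine csSup_le ⟨_, _, isDPCPrecoder_zero h hρ, rfl⟩ ?_
  rintro s ⟨w, hw, rfl⟩
  exact sum_dpcRate_le hμ hw

/-- The power allocation proportional to the weights is admissible: transmit along the conjugates of
the projected channel vectors. -/
lemma propWeightedSumRate_le_maxWeightedSumRate {K M : ℕ} {μ : Fin K → ℝ} (hμ : ∀ k, 0 < μ k)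
    (hμsum : ∑ k, μ k = 1) (h : Channel K M) {ρ : ℝ} (hρ : 0 ≤ ρ) :
    propWeightedSumRate μ h ρ ≤ maxWeightedSumRate μ h ρ := by
  have hbdd : BddAbove {s | ∃ w, IsDPCPrecoder h ρ w ∧ s = ∑ k, μ k * dpcRate h w k} := by
    refine ⟨∑ k, μ k * Real.log (1 + ρ * ‖projVec h k‖ ^ 2), ?_⟩
    rintro s ⟨w, hw, rfl⟩
    exact sum_dpcRate_le hμ hw
  -- a user with `projVec h k = 0` gets the zero vector, by `x / 0 = 0`
  let w : Fin K → EuclideanSpace ℂ (Fin M) := fun k =>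
    conjVec (((√(μ k * ρ) / ‖projVec h k‖ : ℝ) : ℂ) • projVec h k)
  have hrec : ∀ i j, received (h i) (w j) =
      ((√(μ j * ρ) / ‖projVec h j‖ : ℝ) : ℂ) * inner ℂ (projVec h j) (h i) := fun i j => by
    rw [received_eq_inner, conjVec_conjVec, inner_smul_left, Complex.conj_ofReal]
  have hw : IsDPCPrecoder h ρ w := by
    refine ⟨?_, fun i j hij => by rw [hrec, inner_projVec_eq_zero h hij, mul_zero]⟩
    calc ∑ k, ‖w k‖ ^ 2 ≤ ∑ k, μ k * ρ := by
          refine Finset.sum_le_sum fun k _ => ?_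
          have hk : 0 ≤ μ k * ρ := mul_nonneg (hμ k).le hρ
          have h1 : ‖w k‖ = √(μ k * ρ) / ‖projVec h k‖ * ‖projVec h k‖ := by
            rw [norm_conjVec, norm_smul, Complex.norm_real, Real.norm_of_nonneg (by positivity)]
          have h2 : ‖w k‖ ≤ √(μ k * ρ) := by
            rw [h1]
            rcases eq_or_ne ‖projVec h k‖ 0 with hz | hz
            · rw [hz, mul_zero]
              exact Real.sqrt_nonneg _
            · exact (div_mul_cancel₀ _ hz).le
          calc ‖w k‖ ^ 2 ≤ √(μ k * ρ) ^ 2 := pow_le_pow_left₀ (norm_nonneg _) h2 2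
            _ = μ k * ρ := Real.sq_sqrt hk
      _ = ρ := by rw [← Finset.sum_mul, hμsum, one_mul]
  refine le_trans (le_of_eq ?_) (le_csSup hbdd ⟨w, hw, rfl⟩)
  refine Finset.sum_congr rfl fun k _ => ?_
  have hk : 0 ≤ μ k * ρ := mul_nonneg (hμ k).le hρ
  rw [dpcRate, dpcSINR_of_isDPCPrecoder hw, hrec, inner_projVec_self, norm_mul, norm_pow,
    Complex.norm_real, Complex.norm_real, Real.norm_of_nonneg (by positivity), norm_norm]
  congr 3
  by_cases hz : ‖projVec h k‖ = 0
  · simp [hz]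
  · rw [show √(μ k * ρ) / ‖projVec h k‖ * ‖projVec h k‖ ^ 2 = √(μ k * ρ) * ‖projVec h k‖ by
      field_simp, mul_pow, Real.sq_sqrt hk]

/-! ### Polynomial decay of the outage probability -/

lemma tendsto_log_div_log_of_polynomial_bounds {p : ℝ → ℝ} {d : ℝ}
    (hlow : ∀ δ > 0, ∃ c > 0, ∀ᶠ ρ in atTop, c * ρ ^ (-(d + δ)) ≤ p ρ)
    (hup : ∀ δ > 0, ∃ C > 0, ∀ᶠ ρ in atTop, p ρ ≤ C * ρ ^ (-(d - δ))) :
    (∀ᶠ ρ in atTop, 0 < p ρ) ∧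
      Tendsto (fun ρ => Real.log (p ρ) / Real.log ρ) atTop (𝓝 (-d)) := by
  have hpos : ∀ᶠ ρ in atTop, 0 < p ρ := by
    obtain ⟨c, hc, h⟩ := hlow 1 one_pos
    filter_upwards [h, eventually_gt_atTop 0] with ρ hρ hρ0
    exact lt_of_lt_of_le (by positivity) hρ
  refine ⟨hpos, ?_⟩
  have hconst : ∀ c : ℝ, Tendsto (fun ρ : ℝ => c / Real.log ρ) atTop (𝓝 0) := fun c =>
    tendsto_const_nhds.div_atTop Real.tendsto_log_atTop
  rw [tendsto_order]
  constructor
  · intro y hy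
    obtain ⟨c, hc, h⟩ := hlow ((-d - y) / 2) (by linarith)
    filter_upwards [h, hpos, eventually_gt_atTop 1,
      (hconst (Real.log c)).eventually (lt_mem_nhds (show -((-d - y) / 2) < 0 by linarith))]
      with ρ hρ hp hρ1 hcl
    have hl := Real.log_pos hρ1
    have hρ0 : 0 < ρ := by linarith
    have h1 := Real.log_le_log (by positivity) hρ
    rw [Real.log_mul hc.ne' (by positivity), Real.log_rpow hρ0] at h1
    rw [lt_div_iff₀ hl] at hcl ⊢
    nlinarith
  · intro y hy
    obtain ⟨C, hC, h⟩ := hup ((y + d) / 2) (by linarith)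
    filter_upwards [h, hpos, eventually_gt_atTop 1,
      (hconst (Real.log C)).eventually (gt_mem_nhds (show 0 < (y + d) / 2 by linarith))]
      with ρ hρ hp hρ1 hcl
    have hl := Real.log_pos hρ1
    have hρ0 : 0 < ρ := by linarith
    have h1 := Real.log_le_log hp hρ
    rw [Real.log_mul hC.ne' (by positivity), Real.log_rpow hρ0] at h1
    rw [div_lt_iff₀ hl] at hcl ⊢
    nlinarith

lemma log_one_add_rpow_le {ρ : ℝ} (hρ : 1 ≤ ρ) (a : ℝ) :
    Real.log (1 + ρ ^ a) ≤ Real.log 2 + max a 0 * Real.log ρ := by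
  have hρ0 : 0 < ρ := by linarith
  rw [← Real.log_rpow hρ0, ← Real.log_mul two_ne_zero (by positivity)]
  refine Real.log_le_log (by positivity) ?_
  have h1 : ρ ^ a ≤ ρ ^ max a 0 := Real.rpow_le_rpow_of_exponent_le hρ (le_max_left _ _)
  have h2 : 1 ≤ ρ ^ max a 0 := Real.one_le_rpow hρ (le_max_right _ _)
  linarith

/-- If the channel gain of user `k` is at most `ρ ^ (-(v k + ε))`, the weighted sum rate is
eventually below the target rate. For positive multiplexing gain the margin `ε` beats the target
asymptotically; for gain `0` the rate tends to `0` while the target stays away from `0`. -/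
lemma eventually_rate_le {K : ℕ} {μ v : Fin K → ℝ} (hμ : ∀ k, 0 < μ k) (hμsum : ∑ k, μ k = 1)
    (hv1 : ∀ k, v k ≤ 1) {r : ℝ} (hr : K * ∑ k, μ k * (1 - v k) = r)
    {ε : ℝ} (hε : 0 < ε) {R : ℝ → ℝ} (hRpos : ∃ c > 0, ∀ᶠ ρ in atTop, c ≤ R ρ)
    (hR : Tendsto (fun ρ => R ρ / Real.log ρ) atTop (𝓝 r)) :
    ∀ᶠ ρ in atTop, (K : ℝ) * ∑ k, μ k * Real.log (1 + ρ ^ (1 - (v k + ε))) ≤ R ρ := by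
  have hK : (0 : ℝ) < K := by
    rcases Nat.eq_zero_or_pos K with h | h
    · subst h
      simp at hμsum
    · exact_mod_cast h
  have hnn : ∀ k, 0 ≤ μ k * (1 - v k) := fun k =>
    mul_nonneg (hμ k).le (sub_nonneg.2 (hv1 k))
  by_cases hall : ∀ k, v k = 1
  · obtain ⟨c, hc, hcR⟩ := hRpos
    have h1 : Tendsto (fun ρ : ℝ => (K : ℝ) * Real.log (1 + ρ ^ (-ε))) atTop (𝓝 0) := by
      have h2 : Tendsto (fun ρ : ℝ => 1 + ρ ^ (-ε)) atTop (𝓝 (1 + 0)) :=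
        tendsto_const_nhds.add (tendsto_rpow_neg_atTop hε)
      have h3 := (h2.log (by norm_num)).const_mul (K : ℝ)
      simpa using h3
    filter_upwards [hcR, h1.eventually (gt_mem_nhds hc)] with ρ hρ hlt
    have h4 : ∑ k, μ k * Real.log (1 + ρ ^ (1 - (v k + ε))) = Real.log (1 + ρ ^ (-ε)) := by
      simp_rw [hall, show (1 : ℝ) - (1 + ε) = -ε by ring]
      rw [← Finset.sum_mul, hμsum, one_mul]
    rw [h4]
    linarith
  · push Not at hall
    obtain ⟨k₀, hk₀⟩ := hall
    have hlt₀ : v k₀ < 1 := lt_of_le_of_ne (hv1 k₀) hk₀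
    set m : ℝ := K * ∑ k, μ k * max (1 - (v k + ε)) 0 with hm
    have hmr : m < r := by
      rw [hm, ← hr]
      refine mul_lt_mul_of_pos_left (Finset.sum_lt_sum (fun k _ => ?_)
        ⟨k₀, Finset.mem_univ _, ?_⟩) hK
      · exact mul_le_mul_of_nonneg_left (max_le (by linarith) (sub_nonneg.2 (hv1 k))) (hμ k).le
      · exact mul_lt_mul_of_pos_left (max_lt (by linarith) (sub_pos.2 hlt₀)) (hμ k₀)
    have h1 : Tendsto (fun ρ : ℝ => (r - m) / 2 * Real.log ρ) atTop atTop :=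
      Real.tendsto_log_atTop.const_mul_atTop (by linarith)
    filter_upwards [hR.eventually (lt_mem_nhds (show (r + m) / 2 < r by linarith)),
      h1.eventually_ge_atTop (K * Real.log 2), eventually_gt_atTop 1] with ρ hρ hρ2 hρ1
    have hl := Real.log_pos hρ1
    rw [lt_div_iff₀ hl] at hρ
    calc (K : ℝ) * ∑ k, μ k * Real.log (1 + ρ ^ (1 - (v k + ε)))
        ≤ K * ∑ k, μ k * (Real.log 2 + max (1 - (v k + ε)) 0 * Real.log ρ) := by
          gcongr with k
          · exact (hμ k).le
          · exact log_one_add_rpow_le hρ1.le _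
      _ = K * Real.log 2 + m * Real.log ρ := by
          simp_rw [mul_add, Finset.sum_add_distrib, ← mul_assoc, ← Finset.sum_mul, hμsum, hm]
          ring
      _ ≤ R ρ := by linarith

/-- Every feasible profile `v` of channel gains bounds the outage exponent from above. -/
lemma exists_le_outageProb {K M : ℕ} (hKM : K ≤ M) {μ v : Fin K → ℝ}
    (hμ : ∀ k, 0 < μ k) (hμsum : ∑ k, μ k = 1) (hv0 : ∀ k, 0 ≤ v k) (hv1 : ∀ k, v k ≤ 1)
    {r d : ℝ} (hr : K * ∑ k, μ k * (1 - v k) = r) (hd : ∑ k, (dof M k : ℝ) * v k = d)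
    {R : ℝ → ℝ} (hRpos : ∃ c > 0, ∀ᶠ ρ in atTop, c ≤ R ρ)
    (hR : Tendsto (fun ρ => R ρ / Real.log ρ) atTop (𝓝 r)) {δ : ℝ} (hδ : 0 < δ) :
    ∃ c > 0, ∀ᶠ ρ in atTop, c * ρ ^ (-(d + δ)) ≤
      (Measure.pi fun _ : Fin K => gaussianVector M).real
        {h | (K : ℝ) * ∑ k, μ k * Real.log (1 + ρ * ‖projVec h k‖ ^ 2) ≤ R ρ} := by
  obtain ⟨c, hc, hball⟩ := exists_le_forall_projVec_le hKM
  refine ⟨c, hc, ?_⟩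
  have hN : 0 ≤ ∑ k : Fin K, (dof M k : ℝ) := Finset.sum_nonneg fun _ _ => Nat.cast_nonneg _
  set ε : ℝ := δ / (∑ k : Fin K, (dof M k : ℝ) + 1) with hεdef
  have hε : 0 < ε := by positivity
  have hεN : ε * ∑ k : Fin K, (dof M k : ℝ) ≤ δ := by
    rw [hεdef, div_mul_eq_mul_div, div_le_iff₀ (by positivity)]
    nlinarith
  filter_upwards [eventually_rate_le hμ hμsum hv1 hr hε hRpos hR, eventually_ge_atTop 1]
    with ρ hρ hρ1
  have hρ0 : 0 < ρ := by linarith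
  calc c * ρ ^ (-(d + δ)) ≤ c * ∏ k, (ρ ^ (-(v k + ε))) ^ dof M k := by
        refine mul_le_mul_of_nonneg_left ?_ hc.le
        have h1 : ∏ k, (ρ ^ (-(v k + ε))) ^ dof M k = ρ ^ (∑ k : Fin K, -(v k + ε) * dof M k) := by
          rw [Real.rpow_sum_of_pos hρ0]
          refine Finset.prod_congr rfl fun k _ => ?_
          rw [← Real.rpow_natCast, ← Real.rpow_mul hρ0.le]
        rw [h1]
        refine Real.rpow_le_rpow_of_exponent_le hρ1 ?_
        have h2 : ∑ k : Fin K, -(v k + ε) * dof M k = -(d + ε * ∑ k : Fin K, (dof M k : ℝ)) := by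
          rw [← hd, Finset.mul_sum, ← Finset.sum_add_distrib, ← Finset.sum_neg_distrib]
          exact Finset.sum_congr rfl fun k _ => by ring
        rw [h2]
        linarith
    _ ≤ _ := hball _ (fun k => Real.rpow_nonneg hρ0.le _) fun k =>
        Real.rpow_le_one_of_one_le_of_nonpos hρ1 (by linarith [hv0 k])
    _ ≤ _ := by
        refine measureReal_mono fun h hh => ?_
        refine le_trans ?_ hρ
        have hmul : ∀ k, ρ * ‖projVec h k‖ ^ 2 ≤ ρ ^ (1 - (v k + ε)) := fun k => by
          calc ρ * ‖projVec h k‖ ^ 2 ≤ ρ * ρ ^ (-(v k + ε)) :=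
                mul_le_mul_of_nonneg_left (hh k) hρ0.le
            _ = ρ ^ (1 - (v k + ε)) := by
                rw [sub_eq_add_neg, Real.rpow_add hρ0, Real.rpow_one]
        gcongr with k
        · exact (hμ k).le
        · exact hmul k

/-- Every dual multiplier `s` bounds the outage exponent from below. -/
lemma exists_outageProb_le {K M : ℕ} (hKM : K ≤ M) {μ : Fin K → ℝ}
    (hμ : ∀ k, 0 < μ k) (hμsum : ∑ k, μ k = 1) {s r d : ℝ} (hs : 0 ≤ s)
    (hd : d ≤ ∑ k, min (s * μ k) (dof M k) - s * r / K)
    {R : ℝ → ℝ} (hR : Tendsto (fun ρ => R ρ / Real.log ρ) atTop (𝓝 r)) {δ : ℝ} (hδ : 0 < δ) :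
    ∃ C > 0, ∀ᶠ ρ in atTop, (Measure.pi fun _ : Fin K => gaussianVector M).real
        {h | (K : ℝ) * propWeightedSumRate μ h ρ ≤ R ρ} ≤ C * ρ ^ (-(d - δ)) := by
  have hK : (1 : ℝ) ≤ K := by
    rcases Nat.eq_zero_or_pos K with h | h
    · subst h
      simp at hμsum
    · exact_mod_cast h
  have hK0 : (0 : ℝ) < K := by linarith
  have hmin : ∀ k : Fin K, 0 ≤ min (s * μ k) (dof M k) := fun k =>
    le_min (mul_nonneg hs (hμ k).le) (Nat.cast_nonneg _)
  set m : ℝ := ∑ k : Fin K, min (s * μ k) (dof M k) with hm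
  have hm0 : 0 ≤ m := Finset.sum_nonneg fun k _ => hmin k
  obtain ⟨ε, hε0, hε1, hε⟩ : ∃ ε : ℝ, 0 < ε ∧ ε < 1 ∧ ε * (m + s) ≤ δ := by
    refine ⟨min (1 / 2) (δ / (m + s + 1)), by positivity,
      (min_le_left _ _).trans_lt (by norm_num), ?_⟩
    calc min (1 / 2) (δ / (m + s + 1)) * (m + s) ≤ δ / (m + s + 1) * (m + s) :=
          mul_le_mul_of_nonneg_right (min_le_right _ _) (by positivity)
      _ ≤ δ := by
          rw [div_mul_eq_mul_div, div_le_iff₀ (by positivity)]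
          nlinarith
  -- the factor `1 - ε` keeps the exponents strictly below `n_k`, where the moments are finite
  obtain ⟨C, hC, h⟩ := exists_propWeightedSumRate_le (M := M) (a := fun k => (1 - ε) *
      min (s * μ k) (dof M k)) hKM hμ hs (fun k => mul_nonneg (by linarith) (hmin k))
    (fun k => by
      have h1 : (0 : ℝ) < dof M k := by exact_mod_cast Nat.pos_of_ne_zero (dof_ne_zero hKM k)
      have h2 := min_le_right (s * μ k) (dof M k : ℝ)
      nlinarith)
    (fun k => by
      have h2 := min_le_left (s * μ k) (dof M k : ℝ)
      nlinarith [hmin k])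
  refine ⟨C, hC, ?_⟩
  filter_upwards [hR.eventually (gt_mem_nhds (show r < r + ε by linarith)),
    eventually_gt_atTop 1] with ρ hρ hρ1
  have hρ0 : 0 < ρ := by linarith
  have hl := Real.log_pos hρ1
  rw [div_lt_iff₀ hl] at hρ
  have hset : {h : Channel K M | (K : ℝ) * propWeightedSumRate μ h ρ ≤ R ρ} =
      {h | propWeightedSumRate μ h ρ ≤ R ρ / K} := by
    ext h
    exact (le_div_iff₀' hK0).symm
  rw [hset]
  refine (h ρ hρ0 (R ρ / K)).trans (mul_le_mul_of_nonneg_left ?_ hC.le)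
  rw [← Finset.mul_sum, ← hm, Real.rpow_def_of_pos hρ0, Real.rpow_def_of_pos hρ0, ← Real.exp_add,
    Real.exp_le_exp]
  have h1 : s * (R ρ / K) ≤ s * ((r + ε) * Real.log ρ / K) :=
    mul_le_mul_of_nonneg_left (div_le_div_of_nonneg_right hρ.le hK0.le) hs
  have h2 : s * (r + ε) / K - (1 - ε) * m ≤ -(d - δ) := by
    have h3 : s * ε / K ≤ s * ε := div_le_self (mul_nonneg hs hε0.le) hK
    have h4 : s * (r + ε) / K = s * r / K + s * ε / K := by ring
    rw [h4]
    linarith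
  calc s * (R ρ / K) + Real.log ρ * -((1 - ε) * m)
      ≤ Real.log ρ * (s * (r + ε) / K - (1 - ε) * m) := by
        have : s * ((r + ε) * Real.log ρ / K) = Real.log ρ * (s * (r + ε) / K) := by ring
        linarith
    _ ≤ Real.log ρ * -(d - δ) := mul_le_mul_of_nonneg_left h2 hl.le

/-- A weighted sum rate between that of the proportional power allocation and that of full power for
every user has diversity `d` at multiplexing gain `r`, provided that `d` is both the cost
`∑ n_k v_k` of a feasible profile `v` of channel gains `ρ ^ (-v k)`, and the value of
the dual program at some multiplier `s`. -/
lemma hasDiversity_of_primal_dual {Ω : Type*} [MeasurableSpace Ω] (P : Measure Ω)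
    [IsProbabilityMeasure P] {K M : ℕ} (hKM : K ≤ M) {H : Ω → Channel K M} (hH : Measurable H)
    (hlaw : P.map H = Measure.pi fun _ : Fin K => gaussianVector M) {μ v : Fin K → ℝ}
    (hμ : ∀ k, 0 < μ k) (hμsum : ∑ k, μ k = 1) {C : ℝ → Channel K M → ℝ}
    (hClow : ∀ ρ > 0, ∀ h, propWeightedSumRate μ h ρ ≤ C ρ h)
    (hCup : ∀ ρ > 0, ∀ h, C ρ h ≤ ∑ k, μ k * Real.log (1 + ρ * ‖projVec h k‖ ^ 2))
    (hv0 : ∀ k, 0 ≤ v k) (hv1 : ∀ k, v k ≤ 1)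
    {r d : ℝ} (hr : K * ∑ k, μ k * (1 - v k) = r) (hd : ∑ k, (dof M k : ℝ) * v k = d)
    {s : ℝ} (hs : 0 ≤ s) (hds : d ≤ ∑ k, min (s * μ k) (dof M k) - s * r / K) :
    HasDiversity P K (fun ρ ω => C ρ (H ω)) r d := by
  intro R hRpos hR
  refine tendsto_log_div_log_of_polynomial_bounds (fun δ hδ => ?_) (fun δ hδ => ?_)
  · obtain ⟨c, hc, h⟩ := exists_le_outageProb hKM hμ hμsum hv0 hv1 hr hd hRpos hR hδ
    refine ⟨c, hc, ?_⟩
    filter_upwards [h, eventually_gt_atTop 0] with ρ hρ hρ0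
    refine hρ.trans ?_
    have hmeas : MeasurableSet {h : Channel K M |
        (K : ℝ) * ∑ k, μ k * Real.log (1 + ρ * ‖projVec h k‖ ^ 2) ≤ R ρ} := by
      refine measurableSet_le (Measurable.const_mul (Finset.measurable_fun_sum _ fun k _ => ?_) _)
        measurable_const
      exact (Real.measurable_log.comp
        ((((measurable_projVec k).norm.pow_const 2).const_mul ρ).const_add 1)).const_mul _
    rw [← hlaw, map_measureReal_apply hH hmeas]
    exact measureReal_mono fun ω hω =>
      (mul_le_mul_of_nonneg_left (hCup ρ hρ0 (H ω)) (Nat.cast_nonneg K)).trans hω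
  · obtain ⟨c, hc, h⟩ := exists_outageProb_le hKM hμ hμsum hs hds hR hδ
    refine ⟨c, hc, ?_⟩
    filter_upwards [h, eventually_gt_atTop 0] with ρ hρ hρ0
    refine le_trans ?_ hρ
    have h1 : P.real {ω | (K : ℝ) * C ρ (H ω) ≤ R ρ} ≤
        P.real (H ⁻¹' {h | (K : ℝ) * propWeightedSumRate μ h ρ ≤ R ρ}) :=
      measureReal_mono fun ω hω =>
        (mul_le_mul_of_nonneg_left (hClow ρ hρ0 (H ω)) (Nat.cast_nonneg K)).trans hω
    refine h1.trans ?_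
    rw [← hlaw]
    have : IsProbabilityMeasure (P.map H) := Measure.isProbabilityMeasure_map hH.aemeasurable
    exact ENNReal.toReal_mono (measure_ne_top _ _) (Measure.le_map_apply hH.aemeasurable _)

lemma propWeightedSumRate_le_fullPower {K M : ℕ} {μ : Fin K → ℝ} (hμ : ∀ k, 0 < μ k)
    (hμsum : ∑ k, μ k = 1) (h : Channel K M) {ρ : ℝ} (hρ : 0 ≤ ρ) :
    propWeightedSumRate μ h ρ ≤ ∑ k, μ k * Real.log (1 + ρ * ‖projVec h k‖ ^ 2) :=
  (propWeightedSumRate_le_maxWeightedSumRate hμ hμsum h hρ).trans (maxWeightedSumRate_le hμ h hρ)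

/-! ### The linear program of the outage exponent -/

/-- The outage exponent at multiplexing gain `r`, as the dual value of the linear program that
minimizes `∑ n_k v_k` subject to `0 ≤ v ≤ 1` and `K ∑ μ_k (1 - v_k) ≤ r`. -/
noncomputable def outageExponent {K : ℕ} (M : ℕ) (μ : Fin K → ℝ) (r : ℝ) : ℝ :=
  sSup {y | ∃ s : ℝ, 0 ≤ s ∧ y = ∑ k, min (s * μ k) (dof M k) - s * r / K}

/-- Weak duality: a feasible `v` and a multiplier `s` that match are both optimal. -/
lemma outageExponent_eq {K M : ℕ} {μ v : Fin K → ℝ} (hK : (K : ℝ) ≠ 0)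
    (hv0 : ∀ k, 0 ≤ v k) (hv1 : ∀ k, v k ≤ 1)
    {r d : ℝ} (hr : K * ∑ k, μ k * (1 - v k) = r) (hd : ∑ k, (dof M k : ℝ) * v k = d)
    {s : ℝ} (hs : 0 ≤ s) (hds : d ≤ ∑ k, min (s * μ k) (dof M k) - s * r / K) :
    outageExponent M μ r = d := by
  have hweak : ∀ s : ℝ, ∑ k, min (s * μ k) (dof M k) - s * r / K ≤ d := fun s => by
    have h1 : s * r / K = ∑ k, s * μ k * (1 - v k) := by
      rw [← hr, mul_left_comm, mul_div_assoc, mul_div_cancel₀ _ hK, Finset.mul_sum]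
      simp_rw [mul_assoc]
    rw [h1, ← hd, ← Finset.sum_sub_distrib]
    refine Finset.sum_le_sum fun k _ => ?_
    have h2 := mul_le_mul_of_nonneg_right (min_le_left (s * μ k) (dof M k : ℝ))
      (sub_nonneg.2 (hv1 k))
    have h3 := mul_le_mul_of_nonneg_right (min_le_right (s * μ k) (dof M k : ℝ)) (hv0 k)
    linarith
  refine IsGreatest.csSup_eq ⟨⟨s, hs, le_antisymm hds (hweak s)⟩, ?_⟩
  rintro y ⟨s', _, rfl⟩
  exact hweak s'

/-- On the `i`-th segment of the tradeoff curve, the optimal profile switches off the users greedily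
by decreasing `μ_k / n_k`, one of them fractionally, and the multiplier is the ratio `n_k / μ_k` of
that user. -/
lemma exists_primal_dual {K M : ℕ} (hKM : K ≤ M) {μ : Fin K → ℝ}
    (hμ : ∀ k, 0 < μ k) (hμsum : ∑ k, μ k = 1) (σ : Equiv.Perm (Fin K))
    (hσ : Antitone fun j => μ (σ j) / (dof M (σ j) : ℝ)) {i : ℕ} (hi : i < K)
    {t : ℝ} (ht : t ∈ Set.Icc (0 : ℝ) 1) :
    ∃ v : Fin K → ℝ, (∀ k, 0 ≤ v k) ∧ (∀ k, v k ≤ 1) ∧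
      K * ∑ k, μ k * (1 - v k) = (1 - t) * gainPoint μ σ i + t * gainPoint μ σ (i + 1) ∧
      ∑ k, (dof M k : ℝ) * v k = (1 - t) * diversityPoint M σ i + t * diversityPoint M σ (i + 1) ∧
      ∃ s : ℝ, 0 ≤ s ∧ (1 - t) * diversityPoint M σ i + t * diversityPoint M σ (i + 1) ≤
        ∑ k, min (s * μ k) (dof M k) -
          s * ((1 - t) * gainPoint μ σ i + t * gainPoint μ σ (i + 1)) / K := by
  have hK : (K : ℝ) ≠ 0 := by
    have : 0 < K := by omega
    positivity
  let u : Fin K → ℝ := fun j =>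
    (1 - t) * (if j.val < K - i then 1 else 0) + t * (if j.val < K - (i + 1) then 1 else 0)
  have hu : ∀ g : Fin K → ℝ, ∑ k, g k * u (σ.symm k) =
      (1 - t) * ∑ j : Fin K with j.val < K - i, g (σ j) +
        t * ∑ j : Fin K with j.val < K - (i + 1), g (σ j) := by
    intro g
    rw [← Equiv.sum_comp σ, Finset.sum_filter, Finset.sum_filter, Finset.mul_sum, Finset.mul_sum,
      ← Finset.sum_add_distrib]
    refine Finset.sum_congr rfl fun j _ => ?_
    simp only [u, Equiv.symm_apply_apply]
    split_ifs <;> ring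
  have hu0 : ∀ j, 0 ≤ u j := fun j => by
    have h1 := ht.1
    have h2 := ht.2
    simp only [u]
    split_ifs <;> linarith
  have hu1 : ∀ j, u j ≤ 1 := fun j => by
    have h1 := ht.1
    have h2 := ht.2
    simp only [u]
    split_ifs <;> linarith
  have hgain : K * ∑ k, μ k * (1 - u (σ.symm k)) =
      (1 - t) * gainPoint μ σ i + t * gainPoint μ σ (i + 1) := by
    simp_rw [mul_sub, mul_one, Finset.sum_sub_distrib, hu, hμsum, gainPoint]
    ring
  have hdiv := hu fun k => (dof M k : ℝ)
  refine ⟨fun k => u (σ.symm k), fun k => hu0 _, fun k => hu1 _, hgain, hdiv, ?_⟩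
  have hn : ∀ k : Fin K, (0 : ℝ) < dof M k := fun k => by
    exact_mod_cast Nat.pos_of_ne_zero (dof_ne_zero hKM k)
  let q : Fin K := ⟨K - (i + 1), by omega⟩
  set s : ℝ := dof M (σ q) / μ (σ q) with hs
  refine ⟨s, (div_pos (hn _) (hμ _)).le, ?_⟩
  have h1 : s * (K * ∑ k, μ k * (1 - u (σ.symm k))) / K =
      ∑ k, s * μ k * (1 - u (σ.symm k)) := by
    rw [mul_left_comm, mul_div_assoc, mul_div_cancel₀ _ hK, Finset.mul_sum]
    simp_rw [mul_assoc]
  rw [← hgain, h1, ← Finset.sum_sub_distrib]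
  unfold diversityPoint
  rw [← hdiv]
  refine Finset.sum_le_sum fun k _ => ?_
  obtain ⟨j, rfl⟩ := σ.surjective k
  rw [Equiv.symm_apply_apply]
  -- complementary slackness at each user
  rcases lt_trichotomy j q with hj | hj | hj
  · have hj' : j.val < K - (i + 1) := hj
    have huj : u j = 1 := by
      simp only [u, if_pos hj', if_pos (show j.val < K - i by omega)]
      ring
    have h2 := hσ hj.le
    simp only at h2
    rw [div_le_div_iff₀ (hn _) (hn _)] at h2
    have h3 : (dof M (σ j) : ℝ) ≤ s * μ (σ j) := by
      rw [hs, div_mul_eq_mul_div, le_div_iff₀ (hμ _)]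
      linarith
    rw [huj, min_eq_right h3]
    linarith
  · have h3 : s * μ (σ j) = dof M (σ j) := by
      rw [hj, hs]
      exact div_mul_cancel₀ _ (hμ _).ne'
    rw [h3, min_self]
    linarith
  · have hj' : K - (i + 1) < j.val := hj
    have huj : u j = 0 := by
      simp only [u, if_neg (show ¬ j.val < K - (i + 1) by omega),
        if_neg (show ¬ j.val < K - i by omega)]
      ring
    have h2 := hσ hj.le
    simp only at h2
    rw [div_le_div_iff₀ (hn _) (hn _)] at h2
    have h3 : s * μ (σ j) ≤ dof M (σ j) := by
      rw [hs, div_mul_eq_mul_div, div_le_iff₀ (hμ _)]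
      linarith
    rw [huj, min_eq_left h3]
    linarith

lemma exists_mem_segment (x : ℕ → ℝ) {N : ℕ} (hN : 0 < N) {r : ℝ} (h0 : x 0 ≤ r) (hr : r ≤ x N) :
    ∃ i < N, ∃ t ∈ Set.Icc (0 : ℝ) 1, r = (1 - t) * x i + t * x (i + 1) := by
  obtain ⟨i, hi, hle, hge⟩ : ∃ i < N, x i ≤ r ∧ r ≤ x (i + 1) := by
    by_contra! hcon
    have : ∀ i ≤ N, x i ≤ r ∧ (i ≠ 0 → x i < r) := by
      intro i
      induction i with
      | zero => exact fun _ => ⟨h0, fun h => absurd rfl h⟩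
      | succ i ih =>
        intro hi
        have h := hcon i hi (ih (by omega)).1
        exact ⟨h.le, fun _ => h⟩
    exact absurd hr (not_le.2 ((this N le_rfl).2 hN.ne'))
  have hmem : r ∈ segment ℝ (x i) (x (i + 1)) := by
    rw [segment_eq_Icc (hle.trans hge)]
    exact ⟨hle, hge⟩
  rw [segment_eq_image] at hmem
  obtain ⟨t, ht, rfl⟩ := hmem
  exact ⟨i, hi, t, ht, by simp [smul_eq_mul]⟩

lemma gainPoint_zero {K : ℕ} {μ : Fin K → ℝ} (hμsum : ∑ k, μ k = 1) (σ : Equiv.Perm (Fin K)) :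
    gainPoint μ σ 0 = 0 := by
  have h : ∑ j : Fin K with j.val < K - 0, μ (σ j) = 1 := by
    rw [Finset.filter_true_of_mem fun j _ => j.2, Equiv.sum_comp σ, hμsum]
  rw [gainPoint, h, sub_self, mul_zero]

lemma gainPoint_self {K : ℕ} (μ : Fin K → ℝ) (σ : Equiv.Perm (Fin K)) :
    gainPoint μ σ K = K := by
  simp [gainPoint]

end BroadcastDMT

theorem theorem4 {Ω : Type*} [MeasurableSpace Ω] (P : Measure Ω) [IsProbabilityMeasure P]
    (K M : ℕ) (hKM : K ≤ M)
    (H : Ω → BroadcastDMT.Channel K M)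
    (hmeas : ∀ k m, Measurable (fun ω => H ω k m))
    (hindep : iIndepFun (fun (p : Fin K × Fin M) (ω : Ω) => H ω p.1 p.2) P)
    (hlaw : ∀ k m, P.map (fun ω => H ω k m) = BroadcastDMT.complexGaussian)
    (μ : Fin K → ℝ) (hμpos : ∀ k, 0 < μ k) (hμsum : ∑ k, μ k = 1) (hμanti : StrictAnti μ)
    (σ : Equiv.Perm (Fin K))
    (hσ : Antitone (fun j => μ (σ j) / (BroadcastDMT.dof M (σ j) : ℝ))) :
    ∃ d : ℝ → ℝ,
      BroadcastDMT.IsDMT P K (fun ρ ω => BroadcastDMT.propWeightedSumRate μ (H ω) ρ) d ∧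
      BroadcastDMT.IsDMT P K (fun ρ ω => BroadcastDMT.maxWeightedSumRate μ (H ω) ρ) d ∧
      BroadcastDMT.ConnectsPoints d K
        (BroadcastDMT.gainPoint μ σ) (BroadcastDMT.diversityPoint M σ) := by
  open BroadcastDMT in
  obtain ⟨hH, hHlaw⟩ := map_channel P H hmeas hindep hlaw
  have hK : 0 < K := by
    rcases Nat.eq_zero_or_pos K with h | h
    · subst h
      simp at hμsum
    · exact h
  have hDMT : ∀ C : ℝ → Channel K M → ℝ,
      (∀ ρ > 0, ∀ h, propWeightedSumRate μ h ρ ≤ C ρ h) →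
      (∀ ρ > 0, ∀ h, C ρ h ≤ ∑ k, μ k * Real.log (1 + ρ * ‖projVec h k‖ ^ 2)) →
      IsDMT P K (fun ρ ω => C ρ (H ω)) (outageExponent M μ) := by
    intro C hlow hup r hr
    obtain ⟨i, hi, t, ht, rfl⟩ := exists_mem_segment (gainPoint μ σ) hK (r := r)
      (by rw [gainPoint_zero hμsum]; exact hr.1) (by rw [gainPoint_self]; exact hr.2)
    obtain ⟨v, hv0, hv1, hvr, hvd, s, hs, hds⟩ := exists_primal_dual hKM hμpos hμsum σ hσ hi ht
    rw [outageExponent_eq (by positivity) hv0 hv1 hvr hvd hs hds]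
    exact hasDiversity_of_primal_dual P hKM hH hHlaw hμpos hμsum hlow hup hv0 hv1 hvr hvd hs hds
  have hseg : ∀ i < K, ∀ t ∈ Set.Icc (0 : ℝ) 1,
      outageExponent M μ ((1 - t) * gainPoint μ σ i + t * gainPoint μ σ (i + 1)) =
        (1 - t) * diversityPoint M σ i + t * diversityPoint M σ (i + 1) := by
    intro i hi t ht
    obtain ⟨v, hv0, hv1, hvr, hvd, s, hs, hds⟩ := exists_primal_dual hKM hμpos hμsum σ hσ hi ht
    exact outageExponent_eq (by positivity) hv0 hv1 hvr hvd hs hds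
  refine ⟨outageExponent M μ, ?_, ?_, fun i hi => ?_, hseg⟩
  · exact hDMT (fun ρ h => propWeightedSumRate μ h ρ) (fun _ _ _ => le_rfl)
      fun ρ hρ h => propWeightedSumRate_le_fullPower hμpos hμsum h hρ.le
  · exact hDMT (fun ρ h => maxWeightedSumRate μ h ρ)
      (fun ρ hρ h => propWeightedSumRate_le_maxWeightedSumRate hμpos hμsum h hρ.le)
      fun ρ hρ h => maxWeightedSumRate_le hμpos h hρ.le
  · rcases hi.lt_or_eq with hlt | rfl
    · simpa using hseg i hlt 0 ⟨le_rfl, zero_le_one⟩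
    · obtain ⟨j, rfl⟩ := Nat.exists_eq_succ_of_ne_zero hK.ne'
      simpa using hseg j (Nat.lt_succ_self j) 1 ⟨zero_le_one, le_rfl⟩
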